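/- Let $A$ be a finite alphabet, let $A^+$ be the set of nonempty finite words over $A$, let $p\ge 2$, and let $\tau:A\to A^+$ be a substitution of constant length $p$ (that is, $|\tau(a)|=p$ for all $a\in A$), extended to words by concatenation. Suppose that $\tau$ is one-to-one ($\tau(a)\ne\tau(b)$ whenever $a\neq b$) and primitive (there is $n\in\mathbb N$ such that every letter $a$ appears in $\tau^n(b)$ for every letter $b$). Give $A^{\mathbb Z}$ the product of the discrete topologies. Let $X_\tau\subseteq A^{\mathbb Z}$ be the subshift generated by $\tau$, that is, the smallest closed shift-invariant set in which all the words $\tau^n(a)$ ($n\in\mathbb N$, $a\in A$) appear; equivalently, $X_\tau$ is the set of two-sided sequences all of whose finite sub-words are sub-words of words $\tau^n(a)$. Suppose that $X_\tau$ is infinite. Let $T$ be the shift homeomorphism of $X_\tau$ and let $\varrho$ be any metric on $X_\tau$ that induces its topology. A pair $(x,y)\in X_\tau\times X_\tau$ is a Li–Yorke pair if $\limsup_{n\to\infty}\varrho(T^nx,T^ny)>0$ and $\liminf_{n\to\infty}\varrho(T^nx,T^ny)=0$. It is a strong Li–Yorke pair if moreover it is recurrent under $T\times T$: for every neighbourhood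 $U$ of $(x,y)$ there are infinitely many $n\in\mathbb N$ with $(T^nx,T^ny)\in U$. A (strong) Li–Yorke orbit is the orbit $\{(T^nx,T^ny):n\in\mathbb Z\}$ of a (strong) Li–Yorke pair. Two words $s,s'$ of the same length have a coincidence if $s_i=s'_i$ for some coordinate $i$. Then the following statements are equivalent: 1. $(X_\tau,T)$ has uncountably many Li–Yorke pairs; 2. $(X_\tau,T)$ has infinitely many Li–Yorke orbits; 3. $(X_\tau,T)$ has at least one strong Li–Yorke pair; 4. $(X_\tau,T)$ has uncountably many strong Li–Yorke orbits; 5. there exist $m\in\mathbb N$, letters $a\neq b$ in $A$ and (possibly empty) words $u,v,w,u',v',w'$ over $A$ with $|u|=|u'|$, $|v|=|v'|$, $|w|=|w'|$ such that $\tau^m(a)=uavaw$, $\tau^m(b)=u'bv'bw'$, and the words $vaw$ and $v'bw'$ have a coincidence. -/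

import Mathlib

open Filter Topology

/-! ### Pairs in a topological dynamical system -/

namespace LiYorke

variable {X : Type*}

/-- `(x, y)` is a Li–Yorke pair of `(X, T)`: `limsup ρ(Tⁿx, Tⁿy) > 0` and
`liminf ρ(Tⁿx, Tⁿy) = 0`. The distance is read in `[0, ∞]`, where the upper and lower limits
always exist. -/
def IsLiYorkePair [MetricSpace X] (T : X → X) (z : X × X) : Prop :=
  0 < limsup (fun n : ℕ => edist (T^[n] z.1) (T^[n] z.2)) atTop ∧
    liminf (fun n : ℕ => edist (T^[n] z.1) (T^[n] z.2)) atTop = 0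

/-- `z` is a recurrent point of `f`: its forward orbit returns infinitely often to each of its
neighbourhoods. -/
def IsRecurrentPt [TopologicalSpace X] (f : X → X) (z : X) : Prop :=
  ∀ U ∈ 𝓝 z, ∃ᶠ n : ℕ in atTop, f^[n] z ∈ U

/-- A strong Li–Yorke pair is a Li–Yorke pair that is recurrent under `T × T`. -/
def IsStrongLiYorkePair [MetricSpace X] (T : X → X) (z : X × X) : Prop :=
  IsLiYorkePair T z ∧ IsRecurrentPt (Prod.map T T) z

/-- The set of Li–Yorke pairs of `(X, T)`. -/
def liYorkePairs [MetricSpace X] (T : Equiv.Perm X) : Set (X × X) :=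
  {z | IsLiYorkePair T z}

/-- The set of strong Li–Yorke pairs of `(X, T)`. -/
def strongLiYorkePairs [MetricSpace X] (T : Equiv.Perm X) : Set (X × X) :=
  {z | IsStrongLiYorkePair T z}

/-- The orbit of a pair under the invertible map `T × T`. -/
def pairOrbit (T : Equiv.Perm X) (z : X × X) : Set (X × X) :=
  Set.range fun n : ℤ => ((T ^ n) z.1, (T ^ n) z.2)

/-- The set of orbits of Li–Yorke pairs. -/
def liYorkeOrbits [MetricSpace X] (T : Equiv.Perm X) : Set (Set (X × X)) :=
  pairOrbit T '' liYorkePairs T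

/-- The set of orbits of strong Li–Yorke pairs. -/
def strongLiYorkeOrbits [MetricSpace X] (T : Equiv.Perm X) : Set (Set (X × X)) :=
  pairOrbit T '' strongLiYorkePairs T

end LiYorke

/-! ### Substitutions and their subshifts -/

namespace Subst

variable {A : Type*}

/-- The extension of a substitution to words, by concatenation. -/
def onWord (τ : A → List A) (w : List A) : List A := w.flatMap τ

/-- The word `τⁿ(a)`. -/
def iter (τ : A → List A) (n : ℕ) (a : A) : List A := (onWord τ)^[n] [a]

/-- `τ` has constant length `p`. -/
def HasConstLength (τ : A → List A) (p : ℕ) : Prop := ∀ a, (τ a).length = p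

/-- `τ` is primitive: for some `n`, each letter appears in `τⁿ(b)` for each letter `b`. -/
def IsPrimitive (τ : A → List A) : Prop := ∃ n : ℕ, ∀ a b : A, a ∈ iter τ n b

/-- The two words, thought of as being of the same length, agree at some coordinate. -/
def HaveCoincidence (u u' : List A) : Prop :=
  ∃ (i : ℕ) (h : i < u.length) (h' : i < u'.length), u[i] = u'[i]

/-- There are `m` and letters `a ≠ b` with `τᵐ(a) = u a v a w`, `τᵐ(b) = u' b v' b w'`, where
`|u| = |u'|`, `|v| = |v'|`, `|w| = |w'|`, and `v a w`, `v' b w'` have a coincidence. -/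
def DoubleReturnCondition (τ : A → List A) : Prop :=
  ∃ (m : ℕ) (a b : A), a ≠ b ∧ ∃ u v w u' v' w' : List A,
    iter τ m a = u ++ [a] ++ v ++ [a] ++ w ∧
    iter τ m b = u' ++ [b] ++ v' ++ [b] ++ w' ∧
    u.length = u'.length ∧ v.length = v'.length ∧ w.length = w'.length ∧
    HaveCoincidence (v ++ [a] ++ w) (v' ++ [b] ++ w')

/-- The word `x_i x_{i+1} … x_{i+n-1}` of a two-sided sequence. -/
def factor (x : ℤ → A) (i : ℤ) (n : ℕ) : List A := List.ofFn fun j : Fin n => x (i + (j : ℕ))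

/-- The shift map on two-sided sequences. -/
def fullShift (A : Type*) : Equiv.Perm (ℤ → A) where
  toFun x := fun i => x (i + 1)
  invFun x := fun i => x (i - 1)
  left_inv x := by funext i; simp
  right_inv x := by funext i; simp

/-- The subshift generated by `τ`: the two-sided sequences all of whose finite sub-words are
sub-words of some `τᵏ(a)`. For primitive `τ` of constant length at least two, it is the smallest
subshift in which all words `τᵏ(a)` appear; see `isLeast_subshift`. -/
def subshift (τ : A → List A) : Set (ℤ → A) :=
  {x | ∀ (i : ℤ) (n : ℕ), ∃ (k : ℕ) (a : A), factor x i n <:+: iter τ k a}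

lemma factor_fullShift (x : ℤ → A) (i : ℤ) (n : ℕ) :
    factor (fullShift A x) i n = factor x (i + 1) n := by
  unfold factor fullShift
  congr 1
  funext j
  change x _ = x _
  congr 1
  ring

lemma fullShift_mem_subshift_iff (τ : A → List A) (x : ℤ → A) :
    fullShift A x ∈ subshift τ ↔ x ∈ subshift τ := by
  constructor
  · intro h i n
    have := h (i - 1) n
    rwa [factor_fullShift, sub_add_cancel] at this
  · intro h i n
    rw [factor_fullShift]
    exact h (i + 1) n

/-- The shift map on the subshift generated by `τ`. -/
def shift (τ : A → List A) : Equiv.Perm (subshift τ) :=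
  (fullShift A).subtypePerm (fullShift_mem_subshift_iff τ)

/-- A subshift: a closed shift-invariant set of two-sided sequences. -/
def IsSubshift [TopologicalSpace A] (S : Set (ℤ → A)) : Prop :=
  IsClosed S ∧ fullShift A ⁻¹' S = S

/-- The word `w` appears in some point of `S`. -/
def AppearsIn (w : List A) (S : Set (ℤ → A)) : Prop :=
  ∃ x ∈ S, ∃ i : ℤ, factor x i w.length = w

lemma getElem_factor (x : ℤ → A) (i : ℤ) (n j : ℕ) (h : j < (factor x i n).length) :
    (factor x i n)[j] = x (i + j) := by
  simp [factor]

lemma length_factor (x : ℤ → A) (i : ℤ) (n : ℕ) : (factor x i n).length = n := by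
  simp [factor]

lemma factor_eq_iff (x : ℤ → A) (i : ℤ) (w : List A) :
    factor x i w.length = w ↔ ∀ (j : ℕ) (h : j < w.length), x (i + j) = w[j] := by
  constructor
  · intro h j hj
    rw [← getElem_factor x i w.length j (by rwa [length_factor])]
    simp [h]
  · intro h
    apply List.ext_getElem (length_factor _ _ _)
    intro j h1 h2
    rw [getElem_factor, h j h2]

lemma factor_congr {x y : ℤ → A} {i : ℤ} {n : ℕ} (h : ∀ j : ℕ, j < n → x (i + j) = y (i + j)) :
    factor x i n = factor y i n := by
  unfold factor
  congr 1
  funext j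
  exact h j j.2

lemma factor_infix (x : ℤ → A) (i : ℤ) (n r m : ℕ) (h : r + m ≤ n) :
    factor x (i + r) m <:+: factor x i n := by
  refine List.infix_iff_getElem?.2 ⟨r, by simpa [length_factor, add_comm] using h, ?_⟩
  intro j hj
  rw [length_factor] at hj
  rw [List.getElem?_eq_getElem (by rw [length_factor]; omega), getElem_factor, getElem_factor]
  congr 2
  push_cast
  ring

lemma onWord_append (τ : A → List A) (u v : List A) :
    onWord τ (u ++ v) = onWord τ u ++ onWord τ v := by
  simp [onWord]

lemma onWord_iterate_append (τ : A → List A) (n : ℕ) (u v : List A) :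
    (onWord τ)^[n] (u ++ v) = (onWord τ)^[n] u ++ (onWord τ)^[n] v := by
  induction n generalizing u v with
  | zero => rfl
  | succ n ih => simp only [Function.iterate_succ, Function.comp, onWord_append, ih]

lemma length_onWord {τ : A → List A} {p : ℕ} (h : HasConstLength τ p) (w : List A) :
    (onWord τ w).length = w.length * p := by
  induction w with
  | nil => simp [onWord]
  | cons a w ih =>
    have : onWord τ (a :: w) = τ a ++ onWord τ w := by simp [onWord]
    rw [this, List.length_append, ih, h a, List.length_cons]
    ring

lemma length_onWord_iterate {τ : A → List A} {p : ℕ} (h : HasConstLength τ p) (n : ℕ)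
    (w : List A) : ((onWord τ)^[n] w).length = w.length * p ^ n := by
  induction n generalizing w with
  | zero => simp
  | succ n ih =>
    rw [Function.iterate_succ_apply, ih, length_onWord h]
    ring

/-- Each `τⁿ(a)` occurs, with arbitrarily long margins on both sides, in some `τᵏ(b)`. -/
lemma exists_margins {τ : A → List A} {p : ℕ} (hp : 2 ≤ p) (hlen : HasConstLength τ p)
    (hprim : IsPrimitive τ) (n : ℕ) (a : A) (L : ℕ) :
    ∃ (k : ℕ) (b : A) (l r : List A),
      iter τ k b = l ++ iter τ n a ++ r ∧ L ≤ l.length ∧ L ≤ r.length := by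
  obtain ⟨K, hK⟩ := hprim
  have hM : 2 * L + 1 < p ^ (2 * L + 1) :=
    lt_of_lt_of_le Nat.lt_two_pow_self (Nat.pow_le_pow_left hp _)
  set M := 2 * L + 1 with hMdef
  have hlenM : (iter τ M a).length = p ^ M := by
    simp [iter, length_onWord_iterate hlen]
  have hL : L < (iter τ M a).length := by omega
  set d := (iter τ M a)[L] with hd
  have hsplit : iter τ M a = (iter τ M a).take L ++ [d] ++ (iter τ M a).drop (L + 1) := by
    simp [hd]
  obtain ⟨l₁, r₁, h₁⟩ := List.append_of_mem (hK a d)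
  have hge : ∀ (q : ℕ) (w : List A), w.length ≤ ((onWord τ)^[q] w).length := by
    intro q w
    rw [length_onWord_iterate hlen]
    exact Nat.le_mul_of_pos_right _ (Nat.pow_pos (by omega))
  refine ⟨n + K + M, a, (onWord τ)^[n + K] ((iter τ M a).take L) ++ (onWord τ)^[n] l₁,
    (onWord τ)^[n] r₁ ++ (onWord τ)^[n + K] ((iter τ M a).drop (L + 1)), ?_, ?_, ?_⟩
  · have e1 : iter τ (n + K + M) a = (onWord τ)^[n + K] (iter τ M a) := by
      simp only [iter, Function.iterate_add_apply]
    have e2 : (onWord τ)^[n + K] [d] =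
        (onWord τ)^[n] l₁ ++ iter τ n a ++ (onWord τ)^[n] r₁ := by
      have h₂ : (onWord τ)^[K] [d] = l₁ ++ [a] ++ r₁ := by
        rw [show (onWord τ)^[K] [d] = iter τ K d from rfl, h₁]; simp
      rw [Function.iterate_add_apply, h₂, onWord_iterate_append, onWord_iterate_append]
      rfl
    rw [e1]
    conv_lhs => rw [hsplit]
    rw [onWord_iterate_append, onWord_iterate_append, e2]
    simp only [List.append_assoc]
  · have := hge (n + K) ((iter τ M a).take L)
    rw [List.length_take] at this
    rw [List.length_append]
    omega
  · have := hge (n + K) ((iter τ M a).drop (L + 1))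
    rw [List.length_drop] at this
    rw [List.length_append]
    omega

lemma isOpen_agree [TopologicalSpace A] [DiscreteTopology A] (x : ℤ → A) (i : ℤ) (n : ℕ) :
    IsOpen {y : ℤ → A | ∀ j : ℕ, j < n → y (i + j) = x (i + j)} := by
  have : {y : ℤ → A | ∀ j : ℕ, j < n → y (i + j) = x (i + j)} =
      ⋂ j ∈ Finset.range n, (fun y : ℤ → A => y (i + j)) ⁻¹' {x (i + j)} := by
    ext y; simp
  rw [this]
  exact isOpen_biInter_finset fun j _ => (isOpen_discrete _).preimage (continuous_apply _)

lemma isClosed_subshift [TopologicalSpace A] [DiscreteTopology A] (τ : A → List A) :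
    IsClosed (subshift τ) := by
  rw [← isOpen_compl_iff, isOpen_iff_mem_nhds]
  intro x hx
  simp only [subshift, Set.mem_compl_iff, Set.mem_ofPred_eq, not_forall] at hx
  obtain ⟨i, n, h⟩ := hx
  filter_upwards [(isOpen_agree x i n).mem_nhds (fun j _ => rfl)] with y hy hmem
  apply h
  rw [← factor_congr hy]
  exact hmem i n

lemma iterate_preimage {S : Set (ℤ → A)} (hS : fullShift A ⁻¹' S = S) (y : ℤ → A) (hy : y ∈ S)
    (s : ℤ) : (fun j => y (j + s)) ∈ S := by
  have hn : ∀ z : ℤ → A, z ∈ S ↔ (fun j => z (j + 1)) ∈ S := by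
    intro z
    conv_lhs => rw [← hS]
    rfl
  induction s with
  | zero => simpa using hy
  | succ i ih =>
    have := (hn _).1 ih
    refine cast ?_ this
    congr 1; funext j; congr 1; ring
  | pred i ih =>
    rw [hn]
    refine cast ?_ ih
    congr 1; funext j; congr 1; ring

/-- Among the subshifts in which all words `τⁿ(a)` appear, `subshift τ` is the smallest. -/
theorem isLeast_subshift [Finite A] [TopologicalSpace A] [DiscreteTopology A]
    {τ : A → List A} {p : ℕ} (hp : 2 ≤ p) (hlen : HasConstLength τ p) (hprim : IsPrimitive τ) :
    IsLeast {S : Set (ℤ → A) | IsSubshift S ∧ ∀ n a, AppearsIn (iter τ n a) S} (subshift τ) := by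
  refine ⟨⟨⟨isClosed_subshift τ, Set.ext fun x => fullShift_mem_subshift_iff τ x⟩, ?_⟩, ?_⟩
  · intro n a
    -- points that show `τⁿ(a)` at `0`, and whose window of radius `L` is in the language
    let F : ℕ → Set (ℤ → A) := fun L =>
      {x | factor x 0 (iter τ n a).length = iter τ n a ∧
        ∃ k b, factor x (-(L : ℤ)) (2 * L) <:+: iter τ k b}
    have hclosed : ∀ L, IsClosed (F L) := by
      intro L
      rw [← isOpen_compl_iff, isOpen_iff_mem_nhds]
      intro x hx
      filter_upwards [(isOpen_agree x 0 (iter τ n a).length).mem_nhds (fun j _ => rfl),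
        (isOpen_agree x (-(L : ℤ)) (2 * L)).mem_nhds (fun j _ => rfl)] with y h1 h2 hy
      apply hx
      refine ⟨?_, ?_⟩
      · rw [← factor_congr h1]; exact hy.1
      · rw [← factor_congr h2]; exact hy.2
    have hmono : ∀ L, F (L + 1) ⊆ F L := by
      rintro L x ⟨h, k, b, hk⟩
      refine ⟨h, k, b, List.IsInfix.trans ?_ hk⟩
      have := factor_infix x (-((L + 1 : ℕ) : ℤ)) (2 * (L + 1)) 1 (2 * L) (by omega)
      convert this using 2
      push_cast; ring
    have hne : ∀ L, (F L).Nonempty := by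
      intro L
      obtain ⟨k, b, l, r, hk, hl, hr⟩ := exists_margins hp hlen hprim n a L
      let x : ℤ → A := fun i => ((iter τ k b)[(i + l.length).toNat]?).getD a
      have hx : ∀ (j : ℕ) (h : j < (iter τ k b).length),
          x (-(l.length : ℤ) + j) = (iter τ k b)[j] := by
        intro j h
        have e : (-(l.length : ℤ) + j + l.length).toNat = j := by omega
        simp only [x, e, List.getElem?_eq_getElem h, Option.getD_some]
      have hfac := (factor_eq_iff x _ _).2 hx
      have hlenk : (iter τ k b).length = l.length + (iter τ n a).length + r.length := by
        rw [hk]; simp [add_assoc]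
      refine ⟨x, (factor_eq_iff x _ _).2 ?_, k, b, ?_⟩
      · intro j h
        have h' : l.length + j < (iter τ k b).length := by omega
        have := hx (l.length + j) h'
        rw [show (-(l.length : ℤ) + ((l.length + j : ℕ) : ℤ)) = 0 + j by push_cast; ring] at this
        rw [this]
        simp only [hk]
        rw [List.getElem_append_left (by simp; omega), List.getElem_append_right (by omega)]
        simp
      · conv_rhs => rw [← hfac]
        have := factor_infix x (-(l.length : ℤ)) (iter τ k b).length (l.length - L) (2 * L)
          (by
            have : 0 < p ^ n := Nat.pow_pos (by omega)
            omega)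
        convert this using 2
        push_cast [Nat.cast_sub hl]; ring
    obtain ⟨x, hx⟩ := IsCompact.nonempty_iInter_of_sequence_nonempty_isCompact_isClosed F hmono
      hne (hclosed 0).isCompact hclosed
    rw [Set.mem_iInter] at hx
    refine ⟨x, ?_, 0, (hx 0).1⟩
    intro i m
    obtain ⟨-, k, b, hk⟩ := hx (i.natAbs + m)
    refine ⟨k, b, List.IsInfix.trans ?_ hk⟩
    have := factor_infix x (-((i.natAbs + m : ℕ) : ℤ)) (2 * (i.natAbs + m))
      (i + (i.natAbs + m : ℕ)).toNat m (by omega)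
    convert this using 2
    omega
  · rintro S ⟨⟨hcl, hinv⟩, hS⟩ x hx
    rw [← hcl.closure_eq, mem_closure_iff_nhds]
    intro U hU
    rw [nhds_pi, Filter.mem_pi] at hU
    obtain ⟨I, hI, t, ht, hsub⟩ := hU
    obtain ⟨L, hL⟩ : ∃ L : ℕ, ∀ i ∈ I, i.natAbs < L := by
      obtain ⟨B, hB⟩ := (hI.image Int.natAbs).bddAbove
      exact ⟨B + 1, fun i hi => Nat.lt_succ_of_le (hB ⟨i, hi, rfl⟩)⟩
    obtain ⟨k, a, hk⟩ := hx (-(L : ℤ)) (2 * L)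
    obtain ⟨y, hy, s, hs⟩ := hS k a
    rw [factor_eq_iff] at hs
    obtain ⟨q, hq, hget⟩ := List.infix_iff_getElem?.1 hk
    rw [length_factor] at hq
    refine ⟨fun j => y (j + (s + q + L)), hsub ?_, iterate_preimage hinv y hy _⟩
    intro i hi
    have hiL := hL i hi
    have key : y (i + (s + q + L)) = x i := by
      obtain ⟨j, hj⟩ : ∃ j : ℕ, (j : ℤ) = i + L := ⟨(i + L).toNat, by omega⟩
      have hj2 : j < 2 * L := by omega
      have h1 := hget j (by rw [length_factor]; exact hj2)
      rw [List.getElem?_eq_getElem (by omega), Option.some_inj, getElem_factor] at h1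
      rw [← hs _ (by omega)] at h1
      rw [show i = -(L : ℤ) + j by omega, ← h1]
      congr 1; push_cast; ring
    change y (i + (s + q + L)) ∈ t i
    rw [key]
    exact mem_of_mem_nhds (ht i)

end Subst

/-! Recognizability says that the cutting of a point of the subshift into words `τ a` is unique
modulo `p`. A point is therefore the same thing as a tower of successive desubstitutions, and the
two points of a proximal pair have the same sequence of cutting positions, the digits.

If a proximal pair that is not asymptotic is recurrent, or if there are infinitely many orbits of
such pairs, then the pigeonhole principle on the letters at the central coordinates provides
letters `a ≠ b` which return simultaneously, at two places of `τᵐ a` and `τᵐ b`. Proximality yields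
a coincidence to the right of a simultaneous return, and composing the two facts gives the double
return followed by a coincidence.

Conversely, after passing to a power of `τ`, let `i < j` be the places of the two returns in `τ a`
and `τ b`. Towers over `a` and `b` whose digits are `i` and `j`, each infinitely often, encode
infinite binary sequences. Each digit `i` moves the pair close to itself through the return at `j`,
and brings its two points close together through the coincidence to the right of `i`. -/

namespace Subst

variable {A : Type*} {τ : A → List A} {p : ℕ}

/-- The two-sided sequence `x` moved `k` places to the left: the `k`-th power of the shift,
applied to `x`. -/
def translate (k : ℤ) (x : ℤ → A) : ℤ → A := fun i => x (i + k)

@[simp] lemma translate_apply (k : ℤ) (x : ℤ → A) (i : ℤ) : translate k x i = x (i + k) := rfl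

@[simp] lemma translate_zero (x : ℤ → A) : translate 0 x = x := by
  funext i; simp

@[simp] lemma translate_translate (k l : ℤ) (x : ℤ → A) :
    translate k (translate l x) = translate (k + l) x := by
  funext i; simp [add_assoc]

lemma translate_iterate (k : ℤ) (n : ℕ) : (translate k)^[n] = translate (A := A) (n * k) := by
  induction n with
  | zero => funext x; simp
  | succ n ih =>
    funext x
    rw [Function.iterate_succ_apply', ih, translate_translate]
    congr 1
    push_cast
    ring

lemma translate_eq_translate_iff {k l : ℤ} {x y : ℤ → A} :
    translate k x = translate l y ↔ translate (k - l) x = y := by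
  constructor
  · intro h
    simpa [sub_eq_neg_add] using congrArg (translate (-l)) h
  · rintro rfl
    simp

lemma fullShift_eq_translate (x : ℤ → A) : fullShift A x = translate 1 x := rfl

lemma factor_translate (k : ℤ) (x : ℤ → A) (i : ℤ) (n : ℕ) :
    factor (translate k x) i n = factor x (i + k) n :=
  congrArg List.ofFn (funext fun j => congrArg x (by ring))

lemma factor_add (x : ℤ → A) (i : ℤ) (m n : ℕ) :
    factor x i (m + n) = factor x i m ++ factor x (i + m) n := by
  simp [factor, List.ofFn_add, add_assoc]

/-- The action of a substitution of constant length `p` on two-sided sequences: the word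
`τ (x q)` is written on the coordinates `p q, …, p q + p - 1`. The default of `getD` is never
attained when `τ` does have constant length `p > 0`. -/
def onSeq (τ : A → List A) (p : ℕ) (x : ℤ → A) : ℤ → A :=
  fun i => ((τ (x (i / p)))[(i % p).toNat]?).getD (x (i / p))

lemma onSeq_congr {x y : ℤ → A} {i : ℤ} (h : x (i / p) = y (i / p)) :
    onSeq τ p x i = onSeq τ p y i := by
  simp only [onSeq, h]

lemma onSeq_translate (hp : 0 < p) (k : ℤ) (x : ℤ → A) :
    onSeq τ p (translate k x) = translate (p * k) (onSeq τ p x) := by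
  funext i
  simp only [onSeq, translate_apply, Int.add_mul_ediv_left i k (by omega : (p : ℤ) ≠ 0),
    Int.add_mul_emod_self_left]

lemma onSeq_iterate_translate (hp : 0 < p) (n : ℕ) (k : ℤ) (x : ℤ → A) :
    (onSeq τ p)^[n] (translate k x) = translate (p ^ n * k) ((onSeq τ p)^[n] x) := by
  induction n with
  | zero => simp
  | succ n ih =>
    rw [Function.iterate_succ_apply', ih, onSeq_translate hp, Function.iterate_succ_apply']
    congr 1
    ring

lemma onSeq_iterate_congr (n : ℕ) {x y : ℤ → A} {i : ℤ}
    (h : x (i / (p : ℤ) ^ n) = y (i / (p : ℤ) ^ n)) :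
    (onSeq τ p)^[n] x i = (onSeq τ p)^[n] y i := by
  induction n generalizing i with
  | zero => simpa using h
  | succ n ih =>
    rw [Function.iterate_succ_apply', Function.iterate_succ_apply']
    refine onSeq_congr (ih ?_)
    rwa [Int.ediv_ediv_of_nonneg (by positivity), ← pow_succ']

lemma factor_onSeq_letter (hlen : HasConstLength τ p) (x : ℤ → A) (q : ℤ) :
    factor (onSeq τ p x) (p * q) p = τ (x q) := by
  rw [← hlen (x q), factor_eq_iff]
  intro j hj
  rw [hlen] at hj ⊢
  have hdiv : ((p : ℤ) * q + j) / p = q := by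
    rw [Int.mul_add_ediv_left _ _ (by omega), Int.ediv_eq_zero_of_lt (by omega) (by omega),
      add_zero]
  have hmod : ((p : ℤ) * q + j) % p = j := by
    rw [Int.mul_add_emod_self_left, Int.emod_eq_of_lt (by omega) (by omega)]
  simp only [onSeq, hdiv, hmod, Int.toNat_natCast]
  rw [List.getElem?_eq_getElem (by rwa [hlen]), Option.getD_some]

lemma factor_onSeq (hlen : HasConstLength τ p) (x : ℤ → A) (l : ℤ) (m : ℕ) :
    factor (onSeq τ p x) (p * l) (m * p) = onWord τ (factor x l m) := by
  induction m with
  | zero => simp [factor, onWord]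
  | succ m ih =>
    rw [Nat.succ_mul, factor_add, ih, factor_add, onWord_append, Nat.cast_mul, mul_comm (m : ℤ),
      ← mul_add, factor_onSeq_letter hlen]
    simp [factor, onWord]

lemma factor_onSeq_iterate (hlen : HasConstLength τ p) (x : ℤ → A) (l : ℤ) (m n : ℕ) :
    factor ((onSeq τ p)^[n] x) (p ^ n * l) (m * p ^ n) = (onWord τ)^[n] (factor x l m) := by
  induction n with
  | zero => simp
  | succ n ih =>
    rw [Function.iterate_succ_apply', Function.iterate_succ_apply', ← ih,
      ← factor_onSeq hlen]
    congr 1 <;> ring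

lemma eq_of_onSeq_eq (hlen : HasConstLength τ p) (hinj : Function.Injective τ) {x y : ℤ → A}
    {q : ℤ} (h : ∀ j : ℕ, j < p → onSeq τ p x (p * q + j) = onSeq τ p y (p * q + j)) :
    x q = y q := by
  apply hinj
  rw [← factor_onSeq_letter hlen x, factor_congr h, factor_onSeq_letter hlen]

lemma onSeq_injective (hlen : HasConstLength τ p) (hinj : Function.Injective τ) :
    Function.Injective (onSeq τ p) :=
  fun _ _ h => funext fun _ => eq_of_onSeq_eq hlen hinj fun _ _ => by rw [h]

/-- The word `τⁿ(a)` as a two-sided sequence: its letters stand on the coordinates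
`0, …, pⁿ - 1`, and the word is repeated periodically. -/
def block (τ : A → List A) (p n : ℕ) (a : A) : ℤ → A := (onSeq τ p)^[n] fun _ => a

lemma onSeq_iterate_eq_block (hp : 0 < p) (n : ℕ) (x : ℤ → A) {q j : ℤ} (h0 : 0 ≤ j)
    (h1 : j < (p : ℤ) ^ n) : (onSeq τ p)^[n] x (p ^ n * q + j) = block τ p n (x q) j := by
  rw [add_comm, ← translate_apply (p ^ n * q) ((onSeq τ p)^[n] x) j,
    ← onSeq_iterate_translate hp]
  apply onSeq_iterate_congr
  rw [Int.ediv_eq_zero_of_lt h0 h1, translate_apply, zero_add]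

lemma block_add (hp : 0 < p) (m n : ℕ) (a : A) {q j : ℤ} (h0 : 0 ≤ j) (h1 : j < (p : ℤ) ^ n) :
    block τ p (m + n) a (p ^ n * q + j) = block τ p n (block τ p m a q) j := by
  rw [← onSeq_iterate_eq_block hp n _ h0 h1, add_comm m n]
  simp only [block, Function.iterate_add_apply]

lemma length_iter (hlen : HasConstLength τ p) (n : ℕ) (a : A) : (iter τ n a).length = p ^ n := by
  simp [iter, length_onWord_iterate hlen]

lemma factor_onSeq_iterate_letter (hlen : HasConstLength τ p) (x : ℤ → A) (q : ℤ) (n : ℕ) :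
    factor ((onSeq τ p)^[n] x) (p ^ n * q) (p ^ n) = iter τ n (x q) := by
  rw [← one_mul (p ^ n), factor_onSeq_iterate hlen]
  simp [factor, iter]

lemma getElem?_iter (hlen : HasConstLength τ p) (n : ℕ) (a : A) {j : ℕ} (hj : j < p ^ n) :
    (iter τ n a)[j]? = some (block τ p n a j) := by
  have h := factor_onSeq_iterate_letter hlen (fun _ => a) 0 n
  rw [← h, List.getElem?_eq_getElem (by rwa [length_factor]), getElem_factor]
  simp [block]

lemma iter_add (m n : ℕ) (a : A) : iter τ (m + n) a = (onWord τ)^[m] (iter τ n a) :=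
  Function.iterate_add_apply _ m n [a]

lemma iter_succ' (n : ℕ) (a : A) : iter τ (n + 1) a = onWord τ (iter τ n a) :=
  Function.iterate_succ_apply' _ n [a]

lemma translate_mem_subshift {x : ℤ → A} (hx : x ∈ subshift τ) (k : ℤ) :
    translate k x ∈ subshift τ :=
  fun i n => factor_translate k x i n ▸ hx (i + k) n

lemma onSeq_mem_subshift (hlen : HasConstLength τ p) (hp : 0 < p) {x : ℤ → A}
    (hx : x ∈ subshift τ) : onSeq τ p x ∈ subshift τ := by
  intro i n
  obtain ⟨k, a, hk⟩ := hx (i / p) (n + 1)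
  refine ⟨k + 1, a, ?_⟩
  have hle : (i % p).toNat + n ≤ (n + 1) * p := by
    have := Int.emod_lt_of_pos i (by omega : (0 : ℤ) < p)
    nlinarith [Int.toNat_of_nonneg (Int.emod_nonneg i (by omega : (p : ℤ) ≠ 0))]
  have h := factor_infix (onSeq τ p x) (p * (i / p)) _ _ _ hle
  rw [Int.toNat_of_nonneg (Int.emod_nonneg i (by omega)), Int.mul_ediv_add_emod,
    factor_onSeq hlen] at h
  rw [iter_succ']
  exact h.trans (hk.flatMap τ)

end Subst

namespace Subst

variable {A : Type*} {τ : A → List A} {p : ℕ}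

/-- `τ` is a primitive substitution of constant length `p ≥ 2`. -/
structure IsPrimitiveOfLength (τ : A → List A) (p : ℕ) : Prop where
  two_le : 2 ≤ p
  constLength : HasConstLength τ p
  isPrimitive : IsPrimitive τ

/-- `τ` is a one-to-one primitive substitution of constant length `p ≥ 2` with an infinite
subshift, that is, without periodic points of the shift. -/
structure IsAperiodicOfLength (τ : A → List A) (p : ℕ) : Prop extends IsPrimitiveOfLength τ p where
  injective : Function.Injective τ
  infinite : (subshift τ).Infinite

lemma IsPrimitiveOfLength.pos (h : IsPrimitiveOfLength τ p) : 0 < p :=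
  zero_lt_two.trans_le h.two_le

lemma IsPrimitiveOfLength.exists_mem_iter (h : IsPrimitiveOfLength τ p) :
    ∃ K, ∀ n ≥ K, ∀ a b, a ∈ iter τ n b := by
  obtain ⟨K, hK⟩ := h.isPrimitive
  refine ⟨K, fun n hn => ?_⟩
  induction n, hn using Nat.le_induction with
  | base => exact hK
  | succ n _ ih =>
    intro a b
    obtain ⟨c, hc⟩ : ∃ c, c ∈ τ b :=
      List.exists_mem_of_length_pos (h.constLength b ▸ h.pos)
    have hsplit : iter τ (n + 1) b = (onWord τ)^[n] (τ b) := by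
      rw [iter_add]; simp [iter, onWord]
    obtain ⟨u, v, huv⟩ := List.append_of_mem hc
    have happ : τ b = u ++ [c] ++ v := by simp [huv]
    rw [hsplit, happ, onWord_iterate_append, onWord_iterate_append]
    exact List.mem_append_left _ (List.mem_append_right _ (ih a c))

lemma iter_infix_iter_add (m : ℕ) {n : ℕ} {a b : A} (hab : a ∈ iter τ n b) :
    iter τ m a <:+: iter τ (m + n) b := by
  obtain ⟨u, v, huv⟩ := List.append_of_mem hab
  have happ : iter τ n b = u ++ [a] ++ v := by simp [huv]
  rw [iter_add, happ, onWord_iterate_append, onWord_iterate_append]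
  exact ⟨_, _, rfl⟩

lemma IsPrimitiveOfLength.exists_iter_infix (h : IsPrimitiveOfLength τ p) (m : ℕ) :
    ∃ K, ∀ n ≥ K, ∀ a b, iter τ m a <:+: iter τ n b := by
  obtain ⟨K, hK⟩ := h.exists_mem_iter
  refine ⟨m + K, fun n hn a b => ?_⟩
  rw [show n = m + (n - m) by omega]
  exact iter_infix_iter_add m (hK _ (by omega) a b)

/-! ### Powers of a substitution -/

lemma onWord_iter (τ : A → List A) (m : ℕ) : onWord (iter τ m) = (onWord τ)^[m] := by
  funext w
  induction w with
  | nil =>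
    rw [(show Function.IsFixedPt (onWord τ) [] from rfl).iterate m]
    rfl
  | cons a w ih =>
    have hcons : onWord (iter τ m) (a :: w) = iter τ m a ++ onWord (iter τ m) w := by
      simp [onWord]
    rw [hcons, ih, ← List.singleton_append, onWord_iterate_append]
    rfl

lemma iter_iter (τ : A → List A) (m n : ℕ) : iter (iter τ m) n = iter τ (m * n) := by
  funext a
  rw [iter, onWord_iter, ← Function.iterate_mul]
  rfl

lemma onWord_injective (h : HasConstLength τ p) (hp : 0 < p) (hinj : Function.Injective τ) :
    Function.Injective (onWord τ) := by
  intro u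
  induction u with
  | nil =>
    intro v huv
    have := length_onWord h v
    rw [← huv] at this
    exact (List.eq_nil_of_length_eq_zero (by simpa [onWord, hp.ne'] using this)).symm
  | cons a u ih =>
    intro v huv
    have hlen : (a :: u).length = v.length :=
      Nat.eq_of_mul_eq_mul_right hp (by rw [← length_onWord h, ← length_onWord h, huv])
    obtain ⟨b, v, rfl⟩ := List.exists_cons_of_length_eq_add_one hlen.symm
    simp only [onWord, List.flatMap_cons] at huv
    obtain ⟨hab, huv⟩ := List.append_inj huv (by rw [h, h])
    rw [hinj hab, ih huv]

lemma iter_injective (h : HasConstLength τ p) (hp : 0 < p) (hinj : Function.Injective τ) (m : ℕ) :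
    Function.Injective (iter τ m) :=
  ((onWord_injective h hp hinj).iterate m).comp List.singleton_injective

lemma IsPrimitiveOfLength.power (h : IsPrimitiveOfLength τ p) {m : ℕ} (hm : m ≠ 0) :
    IsPrimitiveOfLength (iter τ m) (p ^ m) where
  two_le := h.two_le.trans (Nat.le_self_pow hm p)
  constLength := length_iter h.constLength m
  isPrimitive := by
    obtain ⟨K, hK⟩ := h.exists_mem_iter
    exact ⟨K, fun a b =>
      iter_iter τ m K ▸ hK _ (Nat.le_mul_of_pos_left K (Nat.pos_of_ne_zero hm)) a b⟩

lemma IsPrimitiveOfLength.subshift_power (h : IsPrimitiveOfLength τ p) {m : ℕ} (hm : m ≠ 0) :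
    subshift (iter τ m) = subshift τ := by
  refine Set.Subset.antisymm (fun x hx i n => ?_) fun x hx i n => ?_
  · obtain ⟨k, a, hk⟩ := hx i n
    exact ⟨m * k, a, iter_iter τ m k ▸ hk⟩
  · obtain ⟨k, a, hk⟩ := hx i n
    obtain ⟨K, hK⟩ := h.exists_iter_infix k
    refine ⟨K, a, hk.trans ?_⟩
    rw [iter_iter]
    exact hK _ (Nat.le_mul_of_pos_left K (Nat.pos_of_ne_zero hm)) a a

lemma IsAperiodicOfLength.power (h : IsAperiodicOfLength τ p) {m : ℕ} (hm : m ≠ 0) :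
    IsAperiodicOfLength (iter τ m) (p ^ m) where
  toIsPrimitiveOfLength := h.toIsPrimitiveOfLength.power hm
  injective := iter_injective h.constLength h.pos h.injective m
  infinite := h.subshift_power hm ▸ h.infinite

/-! ### Desubstitution and minimality -/

lemma AppearsIn.of_infix {v w : List A} {S : Set (ℤ → A)} (hw : AppearsIn w S) (hvw : v <:+: w) :
    AppearsIn v S := by
  obtain ⟨x, hx, i, hi⟩ := hw
  obtain ⟨q, hq, hget⟩ := List.infix_iff_getElem?.1 hvw
  refine ⟨x, hx, i + q, (factor_eq_iff x _ v).2 fun j hj => ?_⟩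
  have hj' : j + q < w.length := by omega
  have hv := hget j hj
  rw [List.getElem?_eq_getElem hj', Option.some_inj] at hv
  rw [← hv, ← (factor_eq_iff x i w).1 hi _ hj']
  congr 1
  push_cast
  ring

lemma isSubshift_of_translate [TopologicalSpace A] {S : Set (ℤ → A)} (hS : IsClosed S)
    (hinv : ∀ x ∈ S, ∀ k, translate k x ∈ S) : IsSubshift S := by
  refine ⟨hS, Set.Subset.antisymm (fun x hx => ?_) fun x hx => hinv x hx 1⟩
  simpa [fullShift_eq_translate] using hinv _ hx (-1)

lemma continuous_translate [TopologicalSpace A] (k : ℤ) : Continuous (translate (A := A) k) :=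
  continuous_pi fun i => continuous_apply (i + k)

section Topology

variable [TopologicalSpace A] [DiscreteTopology A]

lemma continuous_onSeq (τ : A → List A) (p : ℕ) : Continuous (onSeq τ p) :=
  continuous_pi fun i =>
    (continuous_of_discreteTopology (f := fun a : A => ((τ a)[(i % p).toNat]?).getD a)).comp
      (continuous_apply (i / p))

variable [Finite A]

lemma isCompact_subshift (τ : A → List A) : IsCompact (subshift τ) :=
  (isClosed_subshift τ).isCompact

lemma IsPrimitiveOfLength.appearsIn_onSeq_image (h : IsPrimitiveOfLength τ p) (n : ℕ) (a : A) :
    AppearsIn (iter τ n a) (onSeq τ p '' subshift τ) := by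
  obtain ⟨K, hK⟩ := h.exists_iter_infix n
  obtain ⟨x, hx, i, hi⟩ := (isLeast_subshift h.two_le h.constLength h.isPrimitive).1.2 K a
  refine AppearsIn.of_infix (w := iter τ (K + 1) a) ⟨_, ⟨x, hx, rfl⟩, p * i, ?_⟩
    (hK _ (Nat.le_succ K) a a)
  rw [iter_succ', length_onWord h.constLength, factor_onSeq h.constLength, hi]

theorem IsPrimitiveOfLength.exists_desubst (h : IsPrimitiveOfLength τ p) {x : ℤ → A}
    (hx : x ∈ subshift τ) :
    ∃ d ∈ Set.Ico (0 : ℤ) p, ∃ y ∈ subshift τ, x = translate d (onSeq τ p y) := by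
  have hp : (0 : ℤ) < p := by exact_mod_cast h.pos
  set S : Set (ℤ → A) :=
    ⋃ d ∈ Set.Ico (0 : ℤ) p, (fun y => translate d (onSeq τ p y)) '' subshift τ with hS
  have hclosed : IsClosed S := (Set.finite_Ico _ _).isClosed_biUnion fun d _ =>
    ((isCompact_subshift τ).image
      ((continuous_translate d).comp (continuous_onSeq τ p))).isClosed
  have hinv : ∀ x ∈ S, ∀ k, translate k x ∈ S := by
    simp only [hS, Set.mem_iUnion, Set.mem_image, exists_prop]
    rintro _ ⟨d, -, y, hy, rfl⟩ k
    refine ⟨(k + d) % p, ⟨Int.emod_nonneg _ hp.ne', Int.emod_lt_of_pos _ hp⟩,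
      translate ((k + d) / p) y, translate_mem_subshift hy _, ?_⟩
    rw [onSeq_translate h.pos, translate_translate, translate_translate, Int.emod_add_mul_ediv]
  have hwords : ∀ n a, AppearsIn (iter τ n a) S := fun n a => by
    obtain ⟨_, ⟨y, hy, rfl⟩, hi⟩ := h.appearsIn_onSeq_image n a
    exact ⟨_, Set.mem_biUnion (Set.left_mem_Ico.2 hp) ⟨y, hy, translate_zero _⟩, hi⟩
  obtain ⟨d, hd, y, hy, hxy⟩ := Set.mem_iUnion₂.1 ((isLeast_subshift h.two_le h.constLength
    h.isPrimitive).2 ⟨isSubshift_of_translate hclosed hinv, hwords⟩ hx)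
  exact ⟨d, hd, y, hy, hxy.symm⟩

lemma IsPrimitiveOfLength.exists_desubst_iterate (h : IsPrimitiveOfLength τ p) (n : ℕ) {x : ℤ → A}
    (hx : x ∈ subshift τ) : ∃ d, ∃ y ∈ subshift τ, x = translate d ((onSeq τ p)^[n] y) := by
  induction n with
  | zero => exact ⟨0, x, hx, by simp⟩
  | succ n ih =>
    obtain ⟨d, y, hy, rfl⟩ := ih
    obtain ⟨e, -, z, hz, rfl⟩ := h.exists_desubst hy
    exact ⟨_, z, hz, by rw [onSeq_iterate_translate h.pos, translate_translate,
      Function.iterate_succ_apply]⟩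

theorem IsPrimitiveOfLength.subshift_minimal (h : IsPrimitiveOfLength τ p) {S : Set (ℤ → A)}
    (hS : IsClosed S) (hinv : ∀ x ∈ S, ∀ k, translate k x ∈ S)
    (hne : (subshift τ ∩ S).Nonempty) : subshift τ ⊆ S := by
  obtain ⟨x, hx, hxS⟩ := hne
  refine (isLeast_subshift h.two_le h.constLength h.isPrimitive).2
    ⟨isSubshift_of_translate hS hinv, fun n a => ?_⟩
  obtain ⟨K, hK⟩ := h.exists_iter_infix n
  obtain ⟨d, y, -, rfl⟩ := h.exists_desubst_iterate K hx
  refine AppearsIn.of_infix (w := iter τ K (y 0)) ⟨_, hxS, -d, ?_⟩ (hK K le_rfl a _)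
  rw [length_iter h.constLength, factor_translate, neg_add_cancel, ← factor_onSeq_iterate_letter
    h.constLength, mul_zero]

end Topology

end Subst

namespace Subst

variable {A : Type*} {τ : A → List A} {p : ℕ}

/-! ### Windows -/

/-- The coordinates at distance at most `L` from `0`. -/
def window (L : ℕ) : Set ℤ := Set.Icc (-L) L

lemma mem_window {L : ℕ} {i : ℤ} : i ∈ window L ↔ -(L : ℤ) ≤ i ∧ i ≤ L := Iff.rfl

lemma window_mono : Monotone window := fun L M h =>
  Set.Icc_subset_Icc (by omega) (by omega)

lemma natAbs_mem_window (i : ℤ) : i ∈ window i.natAbs := by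
  rw [mem_window]; omega

lemma setOf_eqOn_eq_iInter (s : Set ℤ) :
    {z : (ℤ → A) × (ℤ → A) | Set.EqOn z.1 z.2 s} = ⋂ i ∈ s, {z | z.1 i = z.2 i} := by
  ext z
  simp [Set.EqOn]

lemma isClosed_eqOn [TopologicalSpace A] [T2Space A] (s : Set ℤ) :
    IsClosed {z : (ℤ → A) × (ℤ → A) | Set.EqOn z.1 z.2 s} := by
  rw [setOf_eqOn_eq_iInter]
  exact isClosed_biInter fun i _ => isClosed_eq ((continuous_apply i).comp continuous_fst)
    ((continuous_apply i).comp continuous_snd)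

lemma isOpen_eqOn [TopologicalSpace A] [DiscreteTopology A] {s : Set ℤ} (hs : s.Finite) :
    IsOpen {z : (ℤ → A) × (ℤ → A) | Set.EqOn z.1 z.2 s} := by
  rw [setOf_eqOn_eq_iInter]
  exact hs.isOpen_biInter fun i _ => (isOpen_discrete {a : A × A | a.1 = a.2}).preimage
    (f := fun z : (ℤ → A) × (ℤ → A) => (z.1 i, z.2 i)) (by fun_prop)

lemma exists_window_of_isCompact [TopologicalSpace A] [T2Space A]
    {C : Set ((ℤ → A) × (ℤ → A))} (hC : IsCompact C) (hdiag : ∀ z ∈ C, z.1 ≠ z.2) :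
    ∃ L : ℕ, ∀ z ∈ C, ¬ Set.EqOn z.1 z.2 (window L) := by
  have hempty : C ∩ ⋂ L, {z | Set.EqOn z.1 z.2 (window L)} = ∅ := by
    refine Set.eq_empty_of_forall_notMem fun z ⟨hz, hz'⟩ => hdiag z hz ?_
    funext i
    exact Set.mem_iInter.1 hz' i.natAbs (natAbs_mem_window i)
  obtain ⟨L, hL⟩ := hC.elim_directed_family_closed _ (fun L => isClosed_eqOn (window L)) hempty
    (directed_of_isDirected_le fun L M hLM z hz => hz.mono (window_mono hLM))
  exact ⟨L, fun z hz hz' => Set.notMem_empty z (hL ▸ ⟨hz, hz'⟩)⟩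

/-! ### Sliding block codes of radius one -/

/-- The sliding block code of radius one with local rule `φ`. -/
def localMap (φ : A → A → A → A) (x : ℤ → A) : ℤ → A := fun i => φ (x (i - 1)) (x i) (x (i + 1))

lemma commute_localMap_translate (φ : A → A → A → A) (k : ℤ) :
    Function.Commute (localMap φ) (translate k) := fun x => by
  funext i
  simp only [localMap, translate_apply]
  congr 2 <;> ring

lemma continuous_localMap [TopologicalSpace A] [DiscreteTopology A] (φ : A → A → A → A) :
    Continuous (localMap φ) :=
  continuous_pi fun i =>
    (continuous_of_discreteTopology (f := fun a : A × A × A => φ a.1 a.2.1 a.2.2)).comp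
      (f := fun x : ℤ → A => (x (i - 1), x i, x (i + 1))) (by fun_prop)

lemma localMap_iterate_congr (φ : A → A → A → A) (n : ℕ) {x y : ℤ → A} {i : ℤ}
    (h : Set.EqOn x y (Set.Icc (i - n) (i + n))) :
    (localMap φ)^[n] x i = (localMap φ)^[n] y i := by
  induction n generalizing i with
  | zero => exact h (by simp)
  | succ n ih =>
    have hsub : ∀ j ∈ Set.Icc (i - 1) (i + 1), (localMap φ)^[n] x j = (localMap φ)^[n] y j :=
      fun j hj => ih (h.mono (Set.Icc_subset_Icc (by push_cast; linarith [hj.1])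
        (by push_cast; linarith [hj.2])))
    rw [Function.iterate_succ_apply', Function.iterate_succ_apply', localMap, localMap,
      hsub _ ⟨by omega, by omega⟩, hsub _ ⟨by omega, by omega⟩,
      hsub _ ⟨by omega, by omega⟩]

lemma exists_localMap_eqOn {S : Set (ℤ → A)} (hS : ∀ x ∈ S, ∀ k, translate k x ∈ S)
    {f : (ℤ → A) → ℤ → A} (hcomm : ∀ x ∈ S, ∀ k, f (translate k x) = translate k (f x))
    (hloc : ∀ x ∈ S, ∀ y ∈ S, Set.EqOn x y (Set.Icc (-1) 1) → f x 0 = f y 0) :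
    ∃ φ, Set.EqOn (localMap φ) f S := by
  have hrule : ∀ a b c : A, ∃ d, ∀ x ∈ S, x (-1) = a → x 0 = b → x 1 = c → f x 0 = d := by
    intro a b c
    by_cases hex : ∃ y ∈ S, y (-1) = a ∧ y 0 = b ∧ y 1 = c
    · obtain ⟨y, hy, rfl, rfl, rfl⟩ := hex
      refine ⟨f y 0, fun x hx h₁ h₂ h₃ => hloc x hx y hy fun i hi => ?_⟩
      obtain rfl | rfl | rfl : i = -1 ∨ i = 0 ∨ i = 1 := by
        have := hi.1
        have := hi.2
        omega
      exacts [h₁, h₂, h₃]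
    · exact ⟨b, fun x hx h₁ h₂ h₃ => absurd ⟨x, hx, h₁, h₂, h₃⟩ hex⟩
  choose φ hφ using hrule
  refine ⟨φ, fun x hx => funext fun i => ?_⟩
  have h := hφ _ _ _ (translate i x) (hS x hx i) rfl rfl rfl
  rw [hcomm x hx, translate_apply, zero_add] at h
  rw [h, localMap]
  simp only [translate_apply, zero_add, sub_eq_neg_add, add_comm i 1]

/-! ### Recognizability -/

/-- The translations that leave a set of two-sided sequences invariant. -/
def translateStabilizer (S : Set (ℤ → A)) : AddSubgroup ℤ where
  carrier := {k | ∀ x, translate k x ∈ S ↔ x ∈ S}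
  zero_mem' x := by simp
  add_mem' hk hl x := by rw [← translate_translate, hk, hl]
  neg_mem' {k} hk x := by rw [← hk]; simp

/-- An `N`-th root of the shift on the subshift of `τ` given by a radius-one local rule. -/
def IsShiftRoot (τ : A → List A) (N : ℕ) (φ : A → A → A → A) : Prop :=
  Set.MapsTo (localMap φ) (subshift τ) (subshift τ) ∧
    Set.EqOn (localMap φ)^[N] (translate 1) (subshift τ)

lemma isShiftRoot_one (τ : A → List A) : IsShiftRoot τ 1 fun _ _ c => c :=
  ⟨fun _ hx => translate_mem_subshift hx 1, fun _ _ => rfl⟩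

lemma finite_of_translate_eq [Finite A] {S : Set (ℤ → A)} {M : ℕ} (hM : M ≠ 0)
    (hS : ∀ x ∈ S, translate M x = x) : S.Finite := by
  refine Set.Finite.of_injOn (f := fun x (i : Fin M) => x (i : ℕ)) (t := Set.univ)
    (Set.mapsTo_univ _ _) (fun x hx y hy hxy => ?_) Set.finite_univ
  funext i
  have hmod : ∀ z ∈ S, z i = z ((i % M).toNat : ℕ) := fun z hz => by
    have hper : Function.Periodic z M := congrFun (hS z hz)
    have h := hper.int_mul (i / M) (i % M)
    rw [Int.cast_id, mul_comm, Int.emod_add_mul_ediv] at h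
    rw [h, Int.toNat_of_nonneg (Int.emod_nonneg _ (by omega))]
  rw [hmod x hx, hmod y hy]
  have hlt : (i % M).toNat < M := by
    have := Int.emod_lt_of_pos i (b := M) (by omega)
    omega
  exact congrFun hxy ⟨_, hlt⟩

lemma IsShiftRoot.iterate_mul {φ : A → A → A → A} {N : ℕ} (hφ : IsShiftRoot τ N φ) {x : ℤ → A}
    (hx : x ∈ subshift τ) (n : ℕ) : (localMap φ)^[N * n] x = translate n x := by
  induction n with
  | zero => simp
  | succ n ih =>
    rw [Nat.mul_succ, add_comm, Function.iterate_add_apply, ih,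
      hφ.2 (translate_mem_subshift hx _), translate_translate, add_comm, Nat.cast_succ]

lemma IsShiftRoot.of_onSeq (hlen : HasConstLength τ p) (hp : 0 < p) (hinj : Function.Injective τ)
    {g r N : ℕ} (hgr : g * r = p) {φ ψ : A → A → A → A} (hφ : IsShiftRoot τ N φ)
    (hψ : Set.MapsTo (localMap ψ) (subshift τ) (subshift τ))
    (hψφ : ∀ x ∈ subshift τ, onSeq τ p (localMap ψ x) = (localMap φ)^[g] (onSeq τ p x)) :
    IsShiftRoot τ (N * r) ψ := by
  refine ⟨hψ, fun x hx => onSeq_injective hlen hinj ?_⟩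
  have hsemi : ∀ n, onSeq τ p ((localMap ψ)^[n] x) = (localMap φ)^[g * n] (onSeq τ p x) :=
      fun n => by
    induction n with
    | zero => rfl
    | succ n ih =>
      rw [Function.iterate_succ_apply', hψφ _ (hψ.iterate n hx), ih, Nat.mul_succ, add_comm,
        Function.iterate_add_apply]
  rw [hsemi, show g * (N * r) = N * p by rw [← hgr]; ring,
    hφ.iterate_mul (onSeq_mem_subshift hlen hp hx), onSeq_translate hp, mul_one]

lemma localMap_iterate_onSeq_congr (φ : A → A → A → A) {n : ℕ} (hn : n ≤ p) {x y : ℤ → A}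
    (hxy : Set.EqOn x y (Set.Icc (-1) 1)) {i : ℤ} (hi : i ∈ Set.Ico (0 : ℤ) p) :
    (localMap φ)^[n] (onSeq τ p x) i = (localMap φ)^[n] (onSeq τ p y) i := by
  obtain ⟨h0, h1⟩ := hi
  refine localMap_iterate_congr φ n fun t ⟨h2, h3⟩ => onSeq_congr (hxy ⟨?_, ?_⟩)
  · rw [Int.le_ediv_iff_mul_le (by omega)]
    omega
  · rw [← Int.lt_add_one_iff, Int.ediv_lt_iff_lt_mul (by omega)]
    omega

lemma IsShiftRoot.false_of_mul (h : IsAperiodicOfLength τ p) [Finite A] {φ : A → A → A → A}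
    {N R : ℕ} (hR : 2 ≤ R) (h₁ : IsShiftRoot τ N φ) (h₂ : IsShiftRoot τ (N * R) φ) : False := by
  refine h.infinite (finite_of_translate_eq (M := R - 1) (by omega) fun x hx => ?_)
  have heq : translate R x = translate 1 x := (h₁.iterate_mul hx R).symm.trans (h₂.2 hx)
  rw [translate_eq_translate_iff] at heq
  rwa [Nat.cast_sub (by omega), Nat.cast_one]

section Topology

variable [Finite A] [TopologicalSpace A] [DiscreteTopology A]

lemma mapsTo_of_onSeq_mem (h : IsPrimitiveOfLength τ p) {f : (ℤ → A) → ℤ → A}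
    (hf : Continuous f) (hcomm : ∀ k, Function.Commute f (translate k)) {x : ℤ → A}
    (hx : x ∈ subshift τ) (hfx : f (onSeq τ p x) ∈ onSeq τ p '' subshift τ) :
    Set.MapsTo f (onSeq τ p '' subshift τ) (onSeq τ p '' subshift τ) := by
  have hclosed : IsClosed {v | f (onSeq τ p v) ∈ onSeq τ p '' subshift τ} :=
    ((isCompact_subshift τ).image (continuous_onSeq τ p)).isClosed.preimage
      (hf.comp (continuous_onSeq τ p))
  have hinv : ∀ v, f (onSeq τ p v) ∈ onSeq τ p '' subshift τ →
      ∀ k, f (onSeq τ p (translate k v)) ∈ onSeq τ p '' subshift τ := by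
    rintro v ⟨u, hu, huv⟩ k
    exact ⟨translate k u, translate_mem_subshift hu k, by
      rw [onSeq_translate h.pos, onSeq_translate h.pos, huv, (hcomm _).eq]⟩
  rintro _ ⟨v, hv, rfl⟩
  exact h.subshift_minimal hclosed hinv ⟨x, hx, hfx⟩ hv

lemma mem_translateStabilizer_of_eq (h : IsPrimitiveOfLength τ p) {x y : ℤ → A}
    (hx : x ∈ subshift τ) (hy : y ∈ subshift τ) {k : ℤ}
    (hxy : translate k (onSeq τ p x) = onSeq τ p y) :
    k ∈ translateStabilizer (onSeq τ p '' subshift τ) := by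
  have hcomm : ∀ k l : ℤ, Function.Commute (translate (A := A) k) (translate l) := fun k l x => by
    rw [translate_translate, translate_translate, add_comm]
  have hyx : translate (-k) (onSeq τ p y) = onSeq τ p x := by rw [← hxy]; simp
  have hmaps := mapsTo_of_onSeq_mem h (continuous_translate k) (hcomm k) hx ⟨y, hy, hxy.symm⟩
  have hmaps' := mapsTo_of_onSeq_mem h (continuous_translate (-k)) (hcomm (-k)) hy
    ⟨x, hx, hyx.symm⟩
  exact fun z => ⟨fun hz => by simpa using hmaps' hz, fun hz => hmaps hz⟩

lemma exists_localMap_iterate_onSeq (h : IsPrimitiveOfLength τ p) {φ : A → A → A → A}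
    (hφ : Set.MapsTo (localMap φ) (subshift τ) (subshift τ)) :
    ∃ j : ℤ, ∀ (n : ℕ), ∀ v ∈ subshift τ,
      ∃ u ∈ subshift τ, (localMap φ)^[n] (onSeq τ p v) = translate (n * j) (onSeq τ p u) := by
  obtain hempty | ⟨x, hx⟩ := (subshift τ).eq_empty_or_nonempty
  · exact ⟨0, fun n v hv => absurd hv (hempty ▸ Set.notMem_empty v)⟩
  obtain ⟨j, -, u₀, hu₀, hj⟩ :=
    h.exists_desubst (hφ (onSeq_mem_subshift h.constLength h.pos hx))
  have hcomm : ∀ k, Function.Commute (translate (-j) ∘ localMap φ) (translate k) := fun k =>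
    Function.Commute.comp_left (fun x => by simp [add_comm]) (commute_localMap_translate φ k)
  have hmaps := mapsTo_of_onSeq_mem h
    ((continuous_translate (-j)).comp (continuous_localMap φ)) hcomm hx
    ⟨u₀, hu₀, by simp [hj]⟩
  refine ⟨j, fun n v hv => ?_⟩
  induction n with
  | zero => exact ⟨v, hv, by simp⟩
  | succ n ih =>
    obtain ⟨u, hu, hvu⟩ := ih
    obtain ⟨w, hw, huw⟩ := hmaps ⟨u, hu, rfl⟩
    refine ⟨w, hw, ?_⟩
    rw [Function.iterate_succ_apply', hvu, (commute_localMap_translate φ _).eq, huw,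
      Function.comp_apply, translate_translate]
    congr 1
    push_cast
    ring

lemma IsShiftRoot.exists_root (h : IsAperiodicOfLength τ p) {g r N : ℕ} (hgr : g * r = p)
    (hg : (g : ℤ) ∈ translateStabilizer (onSeq τ p '' subshift τ)) {φ : A → A → A → A}
    (hφ : IsShiftRoot τ N φ) : ∃ ψ, IsShiftRoot τ (N * r) ψ := by
  obtain ⟨j, hj⟩ := exists_localMap_iterate_onSeq h.toIsPrimitiveOfLength hφ.1
  have hgp : g ≤ p := Nat.le_of_dvd h.pos ⟨r, hgr.symm⟩
  have hlift : ∀ v ∈ subshift τ, ∃ w ∈ subshift τ,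
      onSeq τ p w = (localMap φ)^[g] (onSeq τ p v) := fun v hv => by
    obtain ⟨u, hu, hvu⟩ := hj g v hv
    have hgj := zsmul_mem hg j
    rw [smul_eq_mul, mul_comm] at hgj
    rw [hvu]
    exact (hgj _).2 ⟨u, hu, rfl⟩
  obtain ⟨x₀, -⟩ := h.infinite.nonempty
  have : Nonempty (ℤ → A) := ⟨x₀⟩
  choose! f hf hfφ using hlift
  have hinj := onSeq_injective h.constLength h.injective
  obtain ⟨ψ, hψ⟩ := exists_localMap_eqOn (f := f) (fun x hx => translate_mem_subshift hx)
    (fun x hx k => hinj (by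
      rw [hfφ _ (translate_mem_subshift hx k), onSeq_translate h.pos, onSeq_translate h.pos,
        hfφ x hx, ((commute_localMap_translate φ _).iterate_left g).eq]))
    (fun x hx y hy hxy => eq_of_onSeq_eq h.constLength h.injective fun i hi => by
      rw [hfφ x hx, hfφ y hy]
      exact localMap_iterate_onSeq_congr φ hgp hxy ⟨by omega, by omega⟩)
  exact ⟨ψ, hφ.of_onSeq h.constLength h.pos h.injective hgr (fun x hx => hψ hx ▸ hf x hx)
    fun x hx => by rw [hψ hx, hfφ x hx]⟩

/-- Were some proper divisor `g = p / r` of `p` to preserve the image of the subshift, the shift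
would have `rⁿ`-th roots with a radius-one local rule for all `n`. There are only finitely many
such rules. -/
lemma dvd_of_mem_translateStabilizer (h : IsAperiodicOfLength τ p) {k : ℤ}
    (hk : k ∈ translateStabilizer (onSeq τ p '' subshift τ)) : (p : ℤ) ∣ k := by
  set G := translateStabilizer (onSeq τ p '' subshift τ)
  obtain ⟨x, hx⟩ := h.infinite.nonempty
  have hpG : (p : ℤ) ∈ G := mem_translateStabilizer_of_eq h.toIsPrimitiveOfLength hx
    (translate_mem_subshift hx 1) (by rw [onSeq_translate h.pos, mul_one])
  obtain ⟨a, ha⟩ := Int.subgroup_cyclic G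
  rw [← AddSubgroup.zmultiples_eq_closure, ← Int.zmultiples_natAbs] at ha
  set g := a.natAbs
  have hgG : (g : ℤ) ∈ G := ha ▸ AddSubgroup.mem_zmultiples _
  rw [ha, Int.mem_zmultiples_iff] at hk hpG
  obtain ⟨r, hr⟩ : g ∣ p := Int.natCast_dvd_natCast.1 hpG
  obtain hr2 | hr2 := le_or_gt 2 r
  · have hroot : ∀ n : ℕ, ∃ φ, IsShiftRoot τ (r ^ n) φ := fun n => by
      induction n with
      | zero => exact ⟨_, isShiftRoot_one τ⟩
      | succ n ih =>
        obtain ⟨φ, hφ⟩ := ih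
        exact hφ.exists_root h hr.symm hgG
    choose φ hφ using hroot
    obtain ⟨m, n, hmn, heq⟩ := Finite.exists_ne_map_eq_of_infinite φ
    wlog hlt : m < n generalizing m n
    · exact this n m hmn.symm heq.symm (lt_of_le_of_ne (not_lt.1 hlt) hmn.symm)
    have hφn := heq ▸ hφ n
    rw [← Nat.add_sub_of_le hlt.le, pow_add] at hφn
    exact ((hφ m).false_of_mul h (hr2.trans (Nat.le_self_pow (by omega) r)) hφn).elim
  · have hr1 : r = 1 := by
      have := h.pos
      interval_cases r <;> omega
    rwa [hr, hr1, mul_one]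

theorem dvd_sub_of_translate_onSeq_eq (h : IsAperiodicOfLength τ p) {x y : ℤ → A}
    (hx : x ∈ subshift τ) (hy : y ∈ subshift τ) {d e : ℤ}
    (hxy : translate d (onSeq τ p x) = translate e (onSeq τ p y)) : (p : ℤ) ∣ d - e :=
  dvd_of_mem_translateStabilizer h (mem_translateStabilizer_of_eq h.toIsPrimitiveOfLength hx hy
    (translate_eq_translate_iff.1 hxy))

theorem exists_window_dvd (h : IsAperiodicOfLength τ p) :
    ∃ L : ℕ, ∀ x ∈ subshift τ, ∀ y ∈ subshift τ, ∀ k l : ℤ,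
      Set.EqOn (translate k (onSeq τ p x)) (translate l (onSeq τ p y)) (window L) →
        (p : ℤ) ∣ k - l := by
  have hp : (0 : ℤ) < p := by exact_mod_cast h.pos
  let K : ℤ → Set (ℤ → A) := fun d => (fun x => translate d (onSeq τ p x)) '' subshift τ
  have hK : ∀ d, IsCompact (K d) := fun d => (isCompact_subshift τ).image
    ((continuous_translate d).comp (continuous_onSeq τ p))
  let D : Set (ℤ × ℤ) := {e ∈ Set.Ico (0 : ℤ) p ×ˢ Set.Ico (0 : ℤ) p | ¬ (p : ℤ) ∣ e.1 - e.2}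
  have hD : D.Finite := ((Set.finite_Ico _ _).prod (Set.finite_Ico _ _)).subset fun _ he => he.1
  obtain ⟨L, hL⟩ := exists_window_of_isCompact
    (hD.isCompact_biUnion fun e _ => (hK e.1).prod (hK e.2)) (by
      rintro ⟨_, _⟩ hz heq
      obtain ⟨e, he, ⟨x, hx, rfl⟩, ⟨y, hy, rfl⟩⟩ := Set.mem_iUnion₂.1 hz
      exact he.2 (dvd_sub_of_translate_onSeq_eq h hx hy heq))
  have hmod : ∀ (k : ℤ) (x : ℤ → A), translate k (onSeq τ p x) =
      translate (k % p) (onSeq τ p (translate (k / p) x)) := fun k x => by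
    rw [onSeq_translate h.pos, translate_translate, Int.emod_add_mul_ediv]
  refine ⟨L, fun x hx y hy k l hkl => by_contra fun hdvd => ?_⟩
  have hmem : ∀ k : ℤ, k % p ∈ Set.Ico (0 : ℤ) p := fun k =>
    ⟨Int.emod_nonneg _ hp.ne', Int.emod_lt_of_pos _ hp⟩
  refine hL (_, _) (Set.mem_biUnion (x := (k % p, l % p)) ⟨⟨hmem k, hmem l⟩, ?_⟩
    ⟨⟨_, translate_mem_subshift hx (k / p), (hmod k x).symm⟩,
      ⟨_, translate_mem_subshift hy (l / p), (hmod l y).symm⟩⟩) hkl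
  rwa [Int.dvd_iff_emod_eq_zero, ← Int.sub_emod, ← Int.dvd_iff_emod_eq_zero]

end Topology

end Subst

namespace Subst

variable {A : Type*} {τ : A → List A} {p : ℕ}

/-! ### Proximal, asymptotic and recurrent pairs -/

/-- Along a sequence of times, the forward orbits of `x` and `y` under the shift come
arbitrarily close to each other. -/
def Proximal (x y : ℤ → A) : Prop :=
  ∀ L : ℕ, ∃ᶠ s : ℕ in atTop, Set.EqOn (translate s x) (translate s y) (window L)

/-- The distance of the forward orbits of `x` and `y` under the shift tends to `0`. -/
def Asymptotic (x y : ℤ → A) : Prop := ∀ᶠ s : ℕ in atTop, x s = y s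

/-- The pair `(x, y)` is a recurrent point of the square of the shift. -/
def RecurrentPair (x y : ℤ → A) : Prop :=
  ∀ L : ℕ, ∃ᶠ s : ℕ in atTop,
    Set.EqOn (translate s x) x (window L) ∧ Set.EqOn (translate s y) y (window L)

lemma Proximal.refl (x : ℤ → A) : Proximal x x := fun _ =>
  (Eventually.of_forall fun _ => Set.eqOn_refl _ _).frequently

lemma eqOn_translate {x y : ℤ → A} {L : ℕ} {k : ℤ}
    (h : Set.EqOn x y (window (L + k.natAbs))) :
    Set.EqOn (translate k x) (translate k y) (window L) := fun i hi => by
  rw [mem_window] at hi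
  have := neg_abs_le k
  have := le_abs_self k
  exact h (mem_window.2 ⟨by omega, by omega⟩)

lemma proximal_translate {x y : ℤ → A} (h : Proximal x y) (k : ℤ) :
    Proximal (translate k x) (translate k y) := fun L =>
  (h (L + k.natAbs)).mono fun s hs => by
    simpa only [translate_translate, add_comm] using eqOn_translate hs

lemma recurrentPair_translate {x y : ℤ → A} (h : RecurrentPair x y) (k : ℤ) :
    RecurrentPair (translate k x) (translate k y) := fun L =>
  (h (L + k.natAbs)).mono fun s hs => by
    simpa only [translate_translate, add_comm] using
      And.intro (eqOn_translate hs.1) (eqOn_translate hs.2)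

lemma Asymptotic.of_translate {x y : ℤ → A} {k : ℤ}
    (h : Asymptotic (translate k x) (translate k y)) : Asymptotic x y := by
  obtain ⟨N, hN⟩ := eventually_atTop.1 h
  filter_upwards [eventually_ge_atTop (N + k.natAbs)] with s hs
  simpa [Int.toNat_of_nonneg (show 0 ≤ (s : ℤ) - k by omega)] using
    hN (s - k).toNat (by omega)

lemma RecurrentPair.not_asymptotic {x y : ℤ → A} (h : RecurrentPair x y) (hxy : x ≠ y) :
    ¬ Asymptotic x y := by
  obtain ⟨i, hi⟩ := Function.ne_iff.1 hxy
  intro hasymp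
  have hi' : Asymptotic (translate i x) (translate i y) :=
    Asymptotic.of_translate (k := -i) (by simpa using hasymp)
  obtain ⟨s, ⟨hsx, hsy⟩, hs⟩ := ((h i.natAbs).and_eventually hi').exists
  rw [translate_apply, translate_apply, add_comm] at hs
  exact hi ((hsx (natAbs_mem_window i)).symm.trans (hs.trans (hsy (natAbs_mem_window i))))

lemma eqOn_window_of_onSeq (hlen : HasConstLength τ p) (hinj : Function.Injective τ) {d : ℤ}
    (hd : d ∈ Set.Ico (0 : ℤ) p) {x y : ℤ → A} {L : ℕ}
    (h : Set.EqOn (translate d (onSeq τ p x)) (translate d (onSeq τ p y)) (window (p * (L + 1)))) :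
    Set.EqOn x y (window L) := fun q ⟨h1, h2⟩ => by
  refine eq_of_onSeq_eq hlen hinj fun j hj => ?_
  have hmem : (p : ℤ) * q + j - d ∈ window (p * (L + 1)) := by
    obtain ⟨h3, h4⟩ := hd
    rw [mem_window]
    push_cast
    constructor <;> nlinarith
  simpa using h hmem

lemma Proximal.of_onSeq (hlen : HasConstLength τ p) (hp : 0 < p) (hinj : Function.Injective τ)
    {x y : ℤ → A} {d : ℤ} (hd : 0 ≤ d)
    (h : Proximal (translate d (onSeq τ p x)) (translate d (onSeq τ p y))) :
    Proximal x y := fun L => by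
  lift d to ℕ using hd
  have htop : Tendsto (fun s => (s + d) / p) atTop atTop :=
    (Nat.tendsto_div_const_atTop hp.ne').comp (tendsto_add_atTop_nat d)
  refine htop.frequently_map _ (fun s hs => ?_) (h (p * (L + 1)))
  have hcut : ∀ z : ℤ → A, translate s (translate d (onSeq τ p z)) =
      translate ((s + d) % p : ℕ)
        (onSeq τ p (translate ((s + d) / p : ℕ) z)) := fun z => by
    rw [onSeq_translate hp, translate_translate, translate_translate]
    congr 1
    exact_mod_cast (Nat.mod_add_div (s + d) p).symm
  rw [hcut, hcut] at hs
  exact eqOn_window_of_onSeq hlen hinj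
    ⟨by positivity, by exact_mod_cast Nat.mod_lt _ hp⟩ hs

section Topology

variable [Finite A] [TopologicalSpace A] [DiscreteTopology A]

lemma Proximal.eq_of_onSeq (h : IsAperiodicOfLength τ p) {x y : ℤ → A} (hx : x ∈ subshift τ)
    (hy : y ∈ subshift τ) {d e : ℤ} (hd : d ∈ Set.Ico (0 : ℤ) p) (he : e ∈ Set.Ico (0 : ℤ) p)
    (hxy : Proximal (translate d (onSeq τ p x)) (translate e (onSeq τ p y))) :
    d = e := by
  obtain ⟨L, hL⟩ := exists_window_dvd h
  obtain ⟨s, hs⟩ := (hxy L).exists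
  rw [translate_translate, translate_translate] at hs
  have hdvd := hL x hx y hy _ _ hs
  rw [add_sub_add_left_eq_sub] at hdvd
  have hlt : |d - e| < p := by
    rw [abs_lt]
    constructor <;> linarith [hd.1, hd.2, he.1, he.2]
  exact sub_eq_zero.1 (Int.eq_zero_of_abs_lt_dvd hdvd hlt)

lemma RecurrentPair.of_onSeq (h : IsAperiodicOfLength τ p) {x y : ℤ → A} (hx : x ∈ subshift τ)
    {d : ℤ} (hd : d ∈ Set.Ico (0 : ℤ) p)
    (hxy : RecurrentPair (translate d (onSeq τ p x)) (translate d (onSeq τ p y))) :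
    RecurrentPair x y := fun L => by
  obtain ⟨L₀, hL₀⟩ := exists_window_dvd h
  refine (Nat.tendsto_div_const_atTop h.pos.ne').frequently_map _ (fun s hs => ?_)
    (hxy (max L₀ (p * (L + 1))))
  have hdvd : (p : ℤ) ∣ s := by
    have hs' := hs.1.mono (window_mono (le_max_left L₀ _))
    rw [translate_translate] at hs'
    simpa using hL₀ x hx x hx _ _ hs'
  have hcut : ∀ z : ℤ → A, translate s (translate d (onSeq τ p z)) =
      translate d (onSeq τ p (translate (s / p : ℕ) z)) := fun z => by
    rw [onSeq_translate h.pos, Int.natCast_div, Int.mul_ediv_cancel' hdvd, translate_translate,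
      translate_translate, add_comm]
  rw [hcut, hcut] at hs
  exact ⟨eqOn_window_of_onSeq h.constLength h.injective hd
      (hs.1.mono (window_mono (le_max_right _ _))),
    eqOn_window_of_onSeq h.constLength h.injective hd
      (hs.2.mono (window_mono (le_max_right _ _)))⟩

end Topology

end Subst

namespace Subst

variable {A : Type*} {τ : A → List A} {p : ℕ}

/-! ### Towers of desubstitutions -/

/-- The integer with base-`p` digits `d 0, …, d (m - 1)`, the least significant first. -/
def offset (p : ℕ) (d : ℕ → ℤ) (m : ℕ) : ℤ := ∑ k ∈ Finset.range m, (p : ℤ) ^ k * d k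

section offset

variable {d : ℕ → ℤ}

lemma offset_succ (p : ℕ) (d : ℕ → ℤ) (m : ℕ) :
    offset p d (m + 1) = offset p d m + p ^ m * d m :=
  Finset.sum_range_succ _ m

lemma offset_nonneg (hd : ∀ n, 0 ≤ d n) (m : ℕ) : 0 ≤ offset p d m :=
  Finset.sum_nonneg fun k _ => mul_nonneg (by positivity) (hd k)

lemma offset_complement (p : ℕ) (d : ℕ → ℤ) (m : ℕ) :
    offset p (fun n => p - 1 - d n) m = p ^ m - 1 - offset p d m := by
  induction m with
  | zero => simp [offset]
  | succ m ih =>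
    rw [offset_succ, offset_succ, ih]
    ring

lemma offset_lt (hd : ∀ n, d n < p) (m : ℕ) : offset p d m < (p : ℤ) ^ m := by
  have h := offset_nonneg (p := p) (d := fun n => p - 1 - d n) (fun n => by have := hd n; omega) m
  rw [offset_complement] at h
  omega

lemma tendsto_offset (hp : 0 < p) (hd : ∀ n, 0 ≤ d n) (hfreq : ∃ᶠ n in atTop, d n ≠ 0) :
    Tendsto (offset p d) atTop atTop := by
  have hmono : Monotone (offset p d) := monotone_nat_of_le_succ fun m => by
    rw [offset_succ]
    exact le_add_of_nonneg_right (mul_nonneg (by positivity) (hd m))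
  have hunbounded : ∀ B : ℕ, ∃ m, (B : ℤ) ≤ offset p d m := fun B => by
    induction B with
    | zero => exact ⟨0, by simp [offset]⟩
    | succ B ih =>
      obtain ⟨m₀, hm₀⟩ := ih
      obtain ⟨m, hm, hne⟩ := hfreq.forall_exists_of_atTop m₀
      have hpos : 0 < (p : ℤ) ^ m * d m := mul_pos (by positivity) ((hd m).lt_of_ne' hne)
      refine ⟨m + 1, ?_⟩
      rw [offset_succ]
      push_cast
      linarith [hmono hm]
  refine tendsto_atTop_atTop_of_monotone hmono fun b => ?_
  obtain ⟨m, hm⟩ := hunbounded b.toNat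
  exact ⟨m, (Int.self_le_toNat b).trans hm⟩

lemma tendsto_pow_sub_offset (hp : 0 < p) (hd : ∀ n, d n < p)
    (hfreq : ∃ᶠ n in atTop, d n ≠ p - 1) :
    Tendsto (fun m => (p : ℤ) ^ m - offset p d m) atTop atTop := by
  refine tendsto_atTop_mono (fun m => ?_) (tendsto_offset (d := fun n => p - 1 - d n) hp
    (fun n => by have := hd n; omega) (hfreq.mono fun n hn => by omega))
  rw [offset_complement]
  omega

end offset

/-- A sequence `X 0` of the subshift together with its successive desubstitutions `X n`: level `n`
is cut into the images of the letters of level `n + 1`, its coordinate `0` being the coordinate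
`d n` of the image of the central letter `X (n + 1) 0`. -/
structure IsTower (τ : A → List A) (p : ℕ) (X : ℕ → ℤ → A) (d : ℕ → ℤ) : Prop where
  mem_subshift : ∀ n, X n ∈ subshift τ
  digit_mem : ∀ n, d n ∈ Set.Ico (0 : ℤ) p
  eq_translate : ∀ n, X n = translate (d n) (onSeq τ p (X (n + 1)))

namespace IsTower

variable {X Y : ℕ → ℤ → A} {d e : ℕ → ℤ}

lemma pos (h : IsTower τ p X d) : 0 < p := by
  obtain ⟨h0, h1⟩ := h.digit_mem 0
  omega

lemma drop (h : IsTower τ p X d) (N : ℕ) :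
    IsTower τ p (fun n => X (N + n)) fun n => d (N + n) :=
  ⟨fun n => h.mem_subshift (N + n), fun n => h.digit_mem (N + n),
    fun n => h.eq_translate (N + n)⟩

lemma eq_translate_iterate (h : IsTower τ p X d) (m : ℕ) :
    X 0 = translate (offset p d m) ((onSeq τ p)^[m] (X m)) := by
  induction m with
  | zero => simp [offset]
  | succ m ih =>
    rw [ih, h.eq_translate m, onSeq_iterate_translate h.pos, translate_translate, offset_succ,
      Function.iterate_succ_apply]

lemma offset_nonneg (h : IsTower τ p X d) (m : ℕ) : 0 ≤ offset p d m :=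
  Subst.offset_nonneg (fun n => (h.digit_mem n).1) m

lemma offset_lt (h : IsTower τ p X d) (m : ℕ) : offset p d m < (p : ℤ) ^ m :=
  Subst.offset_lt (fun n => (h.digit_mem n).2) m

lemma eventually_add_offset_lt (h : IsTower τ p X d) (hfreq : ∃ᶠ n in atTop, d n ≠ p - 1) (i : ℤ) :
    ∀ᶠ m in atTop, i + offset p d m < (p : ℤ) ^ m := by
  filter_upwards [(tendsto_pow_sub_offset h.pos (fun n => (h.digit_mem n).2)
    hfreq).eventually_gt_atTop i] with m hm
  linarith

lemma apply_eq_block (h : IsTower τ p X d) (m : ℕ) (q : ℤ) {i : ℤ} (h0 : 0 ≤ i + offset p d m)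
    (h1 : i + offset p d m < (p : ℤ) ^ m) :
    X 0 (p ^ m * q + i) = block τ p m (X m q) (i + offset p d m) := by
  rw [h.eq_translate_iterate m, translate_apply, add_assoc,
    onSeq_iterate_eq_block h.pos m (X m) h0 h1]

lemma apply_eq_block_zero (h : IsTower τ p X d) (m : ℕ) {i : ℤ} (h0 : 0 ≤ i + offset p d m)
    (h1 : i + offset p d m < (p : ℤ) ^ m) :
    X 0 i = block τ p m (X m 0) (i + offset p d m) := by
  simpa using h.apply_eq_block m 0 h0 h1

lemma translate_levels (h : IsTower τ p X d) {s : ℕ → ℤ} (hs : ∀ n, s n + d n = p * s (n + 1)) :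
    IsTower τ p (fun n => translate (s n) (X n)) 0 where
  mem_subshift n := translate_mem_subshift (h.mem_subshift n) (s n)
  digit_mem _ := ⟨le_rfl, Int.natCast_pos.2 h.pos⟩
  eq_translate n := by
    rw [h.eq_translate n, translate_translate, hs, onSeq_translate h.pos, Pi.zero_apply,
      translate_zero]

end IsTower

lemma exists_carry {d : ℕ → ℤ} (hd : ∀ᶠ n in atTop, d n = p - 1) :
    ∃ s : ℕ → ℤ, ∀ n, s n + d n = p * s (n + 1) := by
  obtain ⟨N, hN⟩ := eventually_atTop.1 hd
  clear hd
  induction N generalizing d with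
  | zero => exact ⟨1, fun n => by simp [hN n (Nat.zero_le n)]⟩
  | succ N ih =>
    obtain ⟨s, hs⟩ := ih (d := fun n => d (n + 1)) fun n hn => hN (n + 1) (by omega)
    refine ⟨fun n => n.casesOn (p * s 0 - d 0) s, fun n => ?_⟩
    cases n with
    | zero => exact sub_add_cancel _ _
    | succ n => exact hs n

section Topology

variable [Finite A] [TopologicalSpace A] [DiscreteTopology A] {X Y : ℕ → ℤ → A} {d e : ℕ → ℤ}

lemma IsPrimitiveOfLength.exists_isTower (h : IsPrimitiveOfLength τ p) {x : ℤ → A}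
    (hx : x ∈ subshift τ) : ∃ X d, IsTower τ p X d ∧ X 0 = x := by
  have hstep : ∀ x ∈ subshift τ, ∃ d ∈ Set.Ico (0 : ℤ) p, ∃ y ∈ subshift τ,
      x = translate d (onSeq τ p y) := fun x hx => h.exists_desubst hx
  have : Nonempty (ℤ → A) := ⟨x⟩
  choose! d hd f hf hdf using hstep
  have hmem : ∀ n, f^[n] x ∈ subshift τ := fun n => Set.MapsTo.iterate hf n hx
  refine ⟨fun n => f^[n] x, fun n => d (f^[n] x), ⟨hmem, fun n => hd _ (hmem n), fun n => ?_⟩, rfl⟩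
  rw [Function.iterate_succ_apply']
  exact hdf _ (hmem n)

lemma IsTower.proximal_and_digit_eq (hX : IsTower τ p X d) (hY : IsTower τ p Y e)
    (h : IsAperiodicOfLength τ p) (hXY : Proximal (X 0) (Y 0)) (n : ℕ) :
    Proximal (X n) (Y n) ∧ d n = e n := by
  have hdigit : ∀ n, Proximal (X n) (Y n) → d n = e n := fun n hn => by
    rw [hX.eq_translate, hY.eq_translate] at hn
    exact hn.eq_of_onSeq h (hX.mem_subshift _) (hY.mem_subshift _) (hX.digit_mem n)
      (hY.digit_mem n)
  have hprox : Proximal (X n) (Y n) := by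
    induction n with
    | zero => exact hXY
    | succ n ih =>
      have hde := hdigit n ih
      rw [hX.eq_translate, hY.eq_translate, hde] at ih
      exact ih.of_onSeq h.constLength h.pos h.injective (hY.digit_mem n).1
  exact ⟨hprox, hdigit n hprox⟩

lemma IsTower.recurrentPair (hX : IsTower τ p X d) (hY : IsTower τ p Y d)
    (h : IsAperiodicOfLength τ p) (hXY : RecurrentPair (X 0) (Y 0)) (n : ℕ) :
    RecurrentPair (X n) (Y n) := by
  induction n with
  | zero => exact hXY
  | succ n ih =>
    rw [hX.eq_translate, hY.eq_translate] at ih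
    exact ih.of_onSeq h (hX.mem_subshift _) (hX.digit_mem n)

/-- If all but finitely many digits are `p - 1`, then moving the pair makes all digits `0`. -/
theorem exists_isTower_of_proximal (h : IsAperiodicOfLength τ p) {x y : ℤ → A}
    (hx : x ∈ subshift τ) (hy : y ∈ subshift τ) (hxy : Proximal x y) :
    ∃ (k : ℤ) (X Y : ℕ → ℤ → A) (d : ℕ → ℤ), IsTower τ p X d ∧ IsTower τ p Y d ∧
      (∃ᶠ n in atTop, d n ≠ p - 1) ∧ X 0 = translate k x ∧ Y 0 = translate k y := by
  obtain ⟨X, d, hX, rfl⟩ := h.exists_isTower hx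
  obtain ⟨Y, e, hY, rfl⟩ := h.exists_isTower hy
  obtain rfl : d = e := funext fun n => (hX.proximal_and_digit_eq hY h hxy n).2
  by_cases hfreq : ∃ᶠ n in atTop, d n ≠ p - 1
  · exact ⟨0, X, Y, d, hX, hY, hfreq, by simp, by simp⟩
  · simp only [not_frequently, not_not] at hfreq
    obtain ⟨s, hs⟩ := exists_carry hfreq
    refine ⟨s 0, _, _, 0, hX.translate_levels hs, hY.translate_levels hs, ?_, rfl, rfl⟩
    have := h.two_le
    exact (Eventually.of_forall fun _ => by rw [Pi.zero_apply]; omega).frequently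

end Topology

end Subst

namespace Subst

variable {A : Type*} {τ : A → List A} {p : ℕ}

/-! ### Common returns -/

/-- The words `τᵐ(a)` and `τᵐ(b)` have the letters `a` and `b`, respectively, at coordinate `i`. -/
structure IsCommonReturn (τ : A → List A) (p m : ℕ) (a b : A) (i : ℤ) : Prop where
  nonneg : 0 ≤ i
  lt : i < (p : ℤ) ^ m
  left : block τ p m a i = a
  right : block τ p m b i = b

/-- The words `τᵐ(a)` and `τᵐ(b)` have the same letter at coordinate `k`. -/
structure IsCoincidence (τ : A → List A) (p m : ℕ) (a b : A) (k : ℤ) : Prop where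
  nonneg : 0 ≤ k
  lt : k < (p : ℤ) ^ m
  eq : block τ p m a k = block τ p m b k

section Words

variable {m : ℕ} {a b : A}

lemma getElem?_iter_eq_some_iff (hlen : HasConstLength τ p) {c : A} {j : ℕ} :
    (iter τ m a)[j]? = some c ↔ j < p ^ m ∧ block τ p m a j = c := by
  rcases lt_or_ge j (p ^ m) with hj | hj
  · rw [getElem?_iter hlen m a hj, Option.some_inj, and_iff_right hj]
  · rw [List.getElem?_eq_none (by rwa [length_iter hlen])]
    simp [hj.not_gt]

lemma isCommonReturn_iff_getElem? (hlen : HasConstLength τ p) {i : ℕ} :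
    IsCommonReturn τ p m a b i ↔
      (iter τ m a)[i]? = some a ∧ (iter τ m b)[i]? = some b := by
  rw [getElem?_iter_eq_some_iff hlen, getElem?_iter_eq_some_iff hlen]
  exact ⟨fun h => ⟨⟨mod_cast h.lt, h.left⟩, mod_cast h.lt, h.right⟩,
    fun h => ⟨Int.natCast_nonneg i, mod_cast h.1.1, h.1.2, h.2.2⟩⟩

lemma isCoincidence_iff_getElem? (hlen : HasConstLength τ p) {k : ℕ} :
    IsCoincidence τ p m a b k ↔
      ∃ c, (iter τ m a)[k]? = some c ∧ (iter τ m b)[k]? = some c := by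
  simp only [getElem?_iter_eq_some_iff hlen]
  exact ⟨fun h => ⟨_, ⟨mod_cast h.lt, rfl⟩, mod_cast h.lt, h.eq.symm⟩,
    fun ⟨_, h⟩ => ⟨Int.natCast_nonneg k, mod_cast h.1.1, h.1.2.trans h.2.2.symm⟩⟩

lemma haveCoincidence_iff_getElem? {u v : List A} :
    HaveCoincidence u v ↔ ∃ (k : ℕ) (c : A), u[k]? = some c ∧ v[k]? = some c := by
  simp only [HaveCoincidence, List.getElem?_eq_some_iff]
  exact ⟨fun ⟨k, hu, hv, h⟩ => ⟨k, _, ⟨hu, rfl⟩, hv, h.symm⟩,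
    fun ⟨k, _, ⟨hu, h⟩, hv, h'⟩ => ⟨k, hu, hv, h.trans h'.symm⟩⟩

lemma getElem?_of_eq_append {l u v w : List A} {c : A} (h : l = u ++ [c] ++ v ++ [c] ++ w) :
    l[u.length]? = some c ∧ l[u.length + 1 + v.length]? = some c ∧
      ∀ t : ℕ, l[u.length + 1 + t]? = (v ++ [c] ++ w)[t]? := by
  have htail : ∀ t : ℕ, l[u.length + 1 + t]? = (v ++ [c] ++ w)[t]? := fun t => by
    rw [show l = (u ++ [c]) ++ (v ++ [c] ++ w) by simp [h],
      List.getElem?_append_right (by simp), List.length_append, List.length_singleton,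
      Nat.add_sub_cancel_left]
  refine ⟨by simp [h], ?_, htail⟩
  rw [htail]
  simp

lemma eq_take_append_drop_of_getElem? {l : List A} {c : A} {i : ℕ} (h : l[i]? = some c) :
    l = l.take i ++ [c] ++ l.drop (i + 1) := by
  obtain ⟨hi, rfl⟩ := List.getElem?_eq_some_iff.1 h
  simp

lemma exists_eq_append_of_getElem? {l : List A} {c : A} {i j : ℕ} (hij : i < j)
    (hi : l[i]? = some c) (hj : l[j]? = some c) :
    ∃ u v w : List A, l = u ++ [c] ++ v ++ [c] ++ w ∧ u.length = i ∧ v.length = j - (i + 1) ∧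
      w.length = l.length - (j + 1) ∧ v ++ [c] ++ w = l.drop (i + 1) := by
  have hj' : (l.drop (i + 1))[j - (i + 1)]? = some c := by
    rw [List.getElem?_drop, Nat.add_sub_cancel' hij, hj]
  have hsplit := eq_take_append_drop_of_getElem? hj'
  have hlt : j < l.length := (List.getElem?_eq_some_iff.1 hj).1
  refine ⟨l.take i, _, _, ?_, by simp; omega, by simp; omega, by simp; omega, hsplit.symm⟩
  conv_lhs => rw [eq_take_append_drop_of_getElem? hi, hsplit]
  simp only [List.append_assoc]

theorem doubleReturnCondition_iff (hlen : HasConstLength τ p) :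
    DoubleReturnCondition τ ↔ ∃ (m : ℕ) (a b : A) (i j k : ℤ), a ≠ b ∧
      IsCommonReturn τ p m a b i ∧ IsCommonReturn τ p m a b j ∧ i < j ∧
      IsCoincidence τ p m a b k ∧ i < k := by
  constructor
  · rintro ⟨m, a, b, hab, u, v, w, u', v', w', ha, hb, hu, hv, -, hc⟩
    obtain ⟨ha₁, ha₂, hat⟩ := getElem?_of_eq_append ha
    obtain ⟨hb₁, hb₂, hbt⟩ := getElem?_of_eq_append hb
    obtain ⟨t, c, hta, htb⟩ := haveCoincidence_iff_getElem?.1 hc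
    rw [← hat] at hta
    rw [← hbt, ← hu] at htb
    rw [← hu] at hb₁ hb₂
    rw [← hv] at hb₂
    exact ⟨m, a, b, u.length, (u.length + 1 + v.length : ℕ), (u.length + 1 + t : ℕ), hab,
      (isCommonReturn_iff_getElem? hlen).2 ⟨ha₁, hb₁⟩,
      (isCommonReturn_iff_getElem? hlen).2 ⟨ha₂, hb₂⟩, by omega,
      (isCoincidence_iff_getElem? hlen).2 ⟨c, hta, htb⟩, by omega⟩
  · rintro ⟨m, a, b, i, j, k, hab, hi, hj, hij, hk, hik⟩
    lift i to ℕ using hi.nonneg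
    lift j to ℕ using hj.nonneg
    lift k to ℕ using hk.nonneg
    norm_cast at hij hik
    obtain ⟨hai, hbi⟩ := (isCommonReturn_iff_getElem? hlen).1 hi
    obtain ⟨haj, hbj⟩ := (isCommonReturn_iff_getElem? hlen).1 hj
    obtain ⟨c, hac, hbc⟩ := (isCoincidence_iff_getElem? hlen).1 hk
    obtain ⟨u, v, w, ha, hu, hv, hw, hvw⟩ := exists_eq_append_of_getElem? hij hai haj
    obtain ⟨u', v', w', hb, hu', hv', hw', hvw'⟩ := exists_eq_append_of_getElem? hij hbi hbj
    refine ⟨m, a, b, hab, u, v, w, u', v', w', ha, hb, hu.trans hu'.symm, hv.trans hv'.symm,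
      by rw [hw, hw', length_iter hlen, length_iter hlen],
      haveCoincidence_iff_getElem?.2 ⟨k - (i + 1), c, ?_, ?_⟩⟩
    · rw [hvw, List.getElem?_drop, Nat.add_sub_cancel' hik, hac]
    · rw [hvw', List.getElem?_drop, Nat.add_sub_cancel' hik, hbc]

end Words

section Composition

variable {m n : ℕ} {a b : A} {i j k q : ℤ}

lemma mul_pow_add_lt_pow_add (hq : q < (p : ℤ) ^ m) (hi : i < (p : ℤ) ^ n) :
    p ^ n * q + i < (p : ℤ) ^ (m + n) := by
  have : (p : ℤ) ^ n * (q + 1) ≤ p ^ n * p ^ m := mul_le_mul_of_nonneg_left hq (by positivity)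
  rw [pow_add]
  linarith

lemma IsCommonReturn.comp (hp : 0 < p) (hq : IsCommonReturn τ p m a b q)
    (hi : IsCommonReturn τ p n a b i) : IsCommonReturn τ p (m + n) a b (p ^ n * q + i) where
  nonneg := add_nonneg (mul_nonneg (by positivity) hq.nonneg) hi.nonneg
  lt := mul_pow_add_lt_pow_add hq.lt hi.lt
  left := by rw [block_add hp m n a hi.nonneg hi.lt, hq.left, hi.left]
  right := by rw [block_add hp m n b hi.nonneg hi.lt, hq.right, hi.right]

lemma IsCoincidence.pow_mul (hp : 0 < p) (hk : IsCoincidence τ p m a b k) (n : ℕ) :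
    IsCoincidence τ p (m + n) a b (p ^ n * k) where
  nonneg := mul_nonneg (by positivity) hk.nonneg
  lt := by simpa using mul_pow_add_lt_pow_add hk.lt (i := 0) (n := n) (by positivity)
  eq := by
    have hpn : (0 : ℤ) < (p : ℤ) ^ n := by positivity
    rw [← add_zero ((p : ℤ) ^ n * k), block_add hp m n a le_rfl hpn,
      block_add hp m n b le_rfl hpn, hk.eq]

/-- Two common returns at one level become, below the common return `q` to the left of the
coincidence `k`, two common returns to the left of a coincidence. -/
lemma IsCommonReturn.eq_of_not_doubleReturnCondition (hlen : HasConstLength τ p) (hp : 0 < p)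
    (hD : ¬ DoubleReturnCondition τ) (hab : a ≠ b) (hq : IsCommonReturn τ p m a b q)
    (hk : IsCoincidence τ p m a b k) (hqk : q < k) (hi : IsCommonReturn τ p n a b i)
    (hj : IsCommonReturn τ p n a b j) : i = j := by
  wlog hij : i < j generalizing i j
  · exact (not_lt.1 hij).eq_or_lt.elim Eq.symm fun hji => (this hj hi hji).symm
  have hlt : p ^ n * q + i < p ^ n * k :=
    calc p ^ n * q + i < p ^ n * q + p ^ n * 1 := by linarith [hi.lt]
      _ = p ^ n * (q + 1) := by ring
      _ ≤ p ^ n * k := mul_le_mul_of_nonneg_left hqk (by positivity)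
  exact (hD ((doubleReturnCondition_iff hlen).2 ⟨m + n, a, b, _, _, _, hab, hq.comp hp hi,
    hq.comp hp hj, by linarith, hk.pow_mul hp n, hlt⟩)).elim

end Composition

lemma frequently_atTop_add {P : ℕ → Prop} (h : ∃ᶠ n in atTop, P n) (N : ℕ) :
    ∃ᶠ n in atTop, P (N + n) := by
  rw [← map_add_atTop_eq_nat N, frequently_map] at h
  simpa only [add_comm] using h

namespace IsTower

variable {X Y X' Y' : ℕ → ℤ → A} {d d' : ℕ → ℤ} {a b : A}

lemma isCommonReturn (hX : IsTower τ p X d) (hY : IsTower τ p Y d) {m : ℕ} {i : ℤ}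
    (h0 : 0 ≤ i + offset p d m) (h1 : i + offset p d m < (p : ℤ) ^ m)
    (hi : X 0 i = a ∧ Y 0 i = b) (hm : X m 0 = a ∧ Y m 0 = b) :
    IsCommonReturn τ p m a b (i + offset p d m) where
  nonneg := h0
  lt := h1
  left := (hm.1 ▸ hX.apply_eq_block_zero m h0 h1).symm.trans hi.1
  right := (hm.2 ▸ hY.apply_eq_block_zero m h0 h1).symm.trans hi.2

lemma isCoincidence (hX : IsTower τ p X d) (hY : IsTower τ p Y d) {m : ℕ} {k : ℤ}
    (h0 : 0 ≤ k + offset p d m) (h1 : k + offset p d m < (p : ℤ) ^ m)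
    (hk : X 0 k = Y 0 k) (hm : X m 0 = a ∧ Y m 0 = b) :
    IsCoincidence τ p m a b (k + offset p d m) where
  nonneg := h0
  lt := h1
  eq := by
    rwa [← hm.1, ← hm.2, ← hX.apply_eq_block_zero m h0 h1, ← hY.apply_eq_block_zero m h0 h1]

lemma ne_of_frequently (hX : IsTower τ p X d) (hY : IsTower τ p Y d)
    (hd : ∃ᶠ n in atTop, d n ≠ p - 1) (hXY : ¬ Asymptotic (X 0) (Y 0))
    (hab : ∃ᶠ n in atTop, X n 0 = a ∧ Y n 0 = b) : a ≠ b := by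
  rintro rfl
  refine hXY (Eventually.of_forall fun s => ?_)
  obtain ⟨m, ⟨hXm, hYm⟩, hm⟩ := (hab.and_eventually (hX.eventually_add_offset_lt hd s)).exists
  have h0 : 0 ≤ s + offset p d m := add_nonneg (Int.natCast_nonneg s) (hX.offset_nonneg m)
  rw [hX.apply_eq_block_zero m h0 hm, hY.apply_eq_block_zero m h0 hm, hXm, hYm]

lemma exists_isCommonReturn_lt_isCoincidence (hX : IsTower τ p X d) (hY : IsTower τ p Y d)
    (hd : ∃ᶠ n in atTop, d n ≠ p - 1) (hXY : Proximal (X 0) (Y 0)) (h0 : X 0 0 = a ∧ Y 0 0 = b)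
    (hab : ∃ᶠ n in atTop, X n 0 = a ∧ Y n 0 = b) :
    ∃ m q k, IsCommonReturn τ p m a b q ∧ IsCoincidence τ p m a b k ∧ q < k := by
  obtain ⟨s, hs, hs1⟩ := ((hXY 0).and_eventually (eventually_ge_atTop 1)).exists
  have hXYs : X 0 s = Y 0 s := by simpa using hs (mem_window.2 ⟨by simp, le_rfl⟩)
  obtain ⟨m, hm, hsm⟩ := (hab.and_eventually (hX.eventually_add_offset_lt hd s)).exists
  have hoff := hX.offset_nonneg m
  exact ⟨m, 0 + offset p d m, s + offset p d m,
    hX.isCommonReturn hY (by omega) (by omega) h0 hm,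
    hX.isCoincidence hY (by omega) hsm hXYs hm, by omega⟩

lemma eq_of_frequently (hX : IsTower τ p X d) (hX' : IsTower τ p X' d')
    (hd : ∃ᶠ n in atTop, d n ≠ p - 1)
    (h : ∃ᶠ n in atTop, offset p d n = offset p d' n ∧ X n 0 = X' n 0 ∧ X n (-1) = X' n (-1)) :
    X 0 = X' 0 := by
  funext i
  obtain ⟨m, ⟨hoff, h0, h1⟩, hm, hm'⟩ := (h.and_eventually
    ((hX.eventually_add_offset_lt hd i).and (hX.eventually_add_offset_lt hd (-i)))).exists
  have := hX.offset_nonneg m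
  rcases le_or_gt 0 (i + offset p d m) with hi | hi
  · rw [hX.apply_eq_block_zero m hi hm, hX'.apply_eq_block_zero m (by omega) (by omega), h0, hoff]
  · rw [show i = p ^ m * (-1) + (i + p ^ m) by ring, hX.apply_eq_block m _ (by omega) (by omega),
      hX'.apply_eq_block m _ (by omega) (by omega), h1, hoff]

lemma eq_translate_of_eq (hX : IsTower τ p X d) (hX' : IsTower τ p X' d') {N : ℕ}
    (hN : X N = X' N) : X 0 = translate (offset p d N - offset p d' N) (X' 0) := by
  rw [hX.eq_translate_iterate N, hX'.eq_translate_iterate N, hN, translate_translate,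
    sub_add_cancel]

end IsTower

lemma exists_eventually_hyperfilter_eq {α : Type*} [Finite α] (f : ℕ → α) :
    ∃ a, ∀ᶠ n in (hyperfilter ℕ : Filter ℕ), f n = a := by
  obtain ⟨a, ha⟩ := Ultrafilter.eq_pure_of_finite ((hyperfilter ℕ).map f)
  refine ⟨a, ?_⟩
  have : {a} ∈ (hyperfilter ℕ).map f := by rw [ha]; exact Set.mem_singleton a
  exact this

lemma frequently_atTop_of_hyperfilter {P : ℕ → Prop}
    (h : ∀ᶠ n in (hyperfilter ℕ : Filter ℕ), P n) : ∃ᶠ n in atTop, P n :=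
  h.frequently.filter_mono Nat.hyperfilter_le_atTop

section Topology

variable [Finite A] [TopologicalSpace A] [DiscreteTopology A]

theorem IsAperiodicOfLength.doubleReturnCondition_of_recurrentPair (h : IsAperiodicOfLength τ p)
    {x y : ℤ → A} (hx : x ∈ subshift τ) (hy : y ∈ subshift τ) (hxy : Proximal x y)
    (hna : ¬ Asymptotic x y) (hrec : RecurrentPair x y) : DoubleReturnCondition τ := by
  obtain ⟨k, X, Y, d, hX, hY, hd, hX0, hY0⟩ := exists_isTower_of_proximal h hx hy hxy
  have hXY : Proximal (X 0) (Y 0) := hX0 ▸ hY0 ▸ proximal_translate hxy k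
  have hXYrec : RecurrentPair (X 0) (Y 0) := hX0 ▸ hY0 ▸ recurrentPair_translate hrec k
  have hXYna : ¬ Asymptotic (X 0) (Y 0) := fun hasymp =>
    hna (Asymptotic.of_translate (k := k) (hX0 ▸ hY0 ▸ hasymp))
  obtain ⟨⟨a, b⟩, hab⟩ := exists_eventually_hyperfilter_eq fun n => (X n 0, Y n 0)
  simp only [Prod.mk.injEq] at hab
  replace hab := frequently_atTop_of_hyperfilter hab
  have hne : a ≠ b := hX.ne_of_frequently hY hd hXYna hab
  obtain ⟨N, hN⟩ := hab.exists
  have hXN := hX.drop N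
  have hYN := hY.drop N
  have hdN := frequently_atTop_add hd N
  have habN := frequently_atTop_add hab N
  by_contra hD
  obtain ⟨m, q, r, hq, hr, hqr⟩ := hXN.exists_isCommonReturn_lt_isCoincidence hYN hdN
    (hX.proximal_and_digit_eq hY h hXY N).1 hN habN
  obtain ⟨s, ⟨hsX, hsY⟩, hs⟩ :=
    ((hX.recurrentPair hY h hXYrec N 0).and_eventually (eventually_ge_atTop 1)).exists
  obtain ⟨n, hn, hsn⟩ := (habN.and_eventually (hXN.eventually_add_offset_lt hdN s)).exists
  have hsN : X N s = a ∧ Y N s = b :=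
    ⟨by simpa [hN.1] using hsX (mem_window.2 ⟨by simp, le_rfl⟩),
      by simpa [hN.2] using hsY (mem_window.2 ⟨by simp, le_rfl⟩)⟩
  have hoff := hXN.offset_nonneg n
  have := hq.eq_of_not_doubleReturnCondition h.constLength h.pos hD hne hr hqr
    (hXN.isCommonReturn hYN (i := 0) (by omega) (by omega) hN hn)
    (hXN.isCommonReturn hYN (i := s) (by omega) hsn hsN hn)
  omega

lemma IsTower.exists_eq_of_not_doubleReturnCondition {X Y X' Y' : ℕ → ℤ → A} {d d' : ℕ → ℤ}
    {a b : A} (h : IsAperiodicOfLength τ p) (hD : ¬ DoubleReturnCondition τ)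
    (hX : IsTower τ p X d) (hY : IsTower τ p Y d) (hX' : IsTower τ p X' d')
    (hY' : IsTower τ p Y' d') (hd : ∃ᶠ n in atTop, d n ≠ p - 1) (hXY : Proximal (X 0) (Y 0))
    (hne : a ≠ b) (hfreq : ∃ᶠ n in atTop, (X n 0 = a ∧ Y n 0 = b) ∧ (X' n 0 = a ∧ Y' n 0 = b) ∧
      X n (-1) = X' n (-1) ∧ Y n (-1) = Y' n (-1)) :
    ∃ N, X N = X' N ∧ Y N = Y' N := by
  obtain ⟨N, hN, hN', -⟩ := hfreq.exists
  have hXN := hX.drop N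
  have hYN := hY.drop N
  have hXN' := hX'.drop N
  have hYN' := hY'.drop N
  have hdN := frequently_atTop_add hd N
  have hfreqN := frequently_atTop_add hfreq N
  obtain ⟨m, q, r, hq, hr, hqr⟩ := hXN.exists_isCommonReturn_lt_isCoincidence hYN hdN
    (hX.proximal_and_digit_eq hY h hXY N).1 hN (hfreqN.mono fun n hn => hn.1)
  have hoffset : ∀ n, X (N + n) 0 = a ∧ Y (N + n) 0 = b → X' (N + n) 0 = a ∧ Y' (N + n) 0 = b →
      offset p (fun n => d (N + n)) n = offset p (fun n => d' (N + n)) n := fun n hn hn' => by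
    simpa only [zero_add] using
      hq.eq_of_not_doubleReturnCondition h.constLength h.pos hD hne hr hqr
        (hXN.isCommonReturn hYN (i := 0) (by simpa using hXN.offset_nonneg n)
          (by simpa using hXN.offset_lt n) hN hn)
        (hXN'.isCommonReturn hYN' (i := 0) (by simpa using hXN'.offset_nonneg n)
          (by simpa using hXN'.offset_lt n) hN' hn')
  exact ⟨N, hXN.eq_of_frequently hXN' hdN (hfreqN.mono fun n ⟨hn, hn', hX1, _⟩ =>
      ⟨hoffset n hn hn', hn.1.trans hn'.1.symm, hX1⟩),
    hYN.eq_of_frequently hYN' hdN (hfreqN.mono fun n ⟨hn, hn', _, hY1⟩ =>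
      ⟨hoffset n hn hn', hn.2.trans hn'.2.symm, hY1⟩)⟩

theorem IsAperiodicOfLength.doubleReturnCondition_of_infinite (h : IsAperiodicOfLength τ p)
    {ι : Type*} [Infinite ι] {x y : ι → ℤ → A} (hx : ∀ i, x i ∈ subshift τ)
    (hy : ∀ i, y i ∈ subshift τ) (hxy : ∀ i, Proximal (x i) (y i))
    (hna : ∀ i, ¬ Asymptotic (x i) (y i))
    (hdisj : ∀ i j k, x i = translate k (x j) → y i = translate k (y j) → i = j) :
    DoubleReturnCondition τ := by
  by_contra hD
  choose k X Y d hX hY hd hX0 hY0 using fun i =>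
    exists_isTower_of_proximal h (hx i) (hy i) (hxy i)
  choose f hf using fun i => exists_eventually_hyperfilter_eq fun n =>
    ((X i n 0, Y i n 0), X i n (-1), Y i n (-1))
  obtain ⟨i, j, hij, hfij⟩ := Finite.exists_ne_map_eq_of_infinite f
  have hfreq := frequently_atTop_of_hyperfilter ((hf i).and (hf j))
  rw [← hfij] at hfreq
  obtain ⟨⟨⟨a, b⟩, a', b'⟩, hfi⟩ : ∃ v, f i = v := ⟨_, rfl⟩
  simp only [hfi, Prod.mk.injEq] at hfreq
  have hXY : Proximal (X i 0) (Y i 0) := hX0 i ▸ hY0 i ▸ proximal_translate (hxy i) (k i)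
  have hne : a ≠ b := (hX i).ne_of_frequently (hY i) (hd i)
    (fun hasymp => hna i (Asymptotic.of_translate (k := k i) (hX0 i ▸ hY0 i ▸ hasymp)))
    (hfreq.mono fun n hn => hn.1.1)
  obtain ⟨N, hXN, hYN⟩ := IsTower.exists_eq_of_not_doubleReturnCondition h hD (hX i) (hY i)
    (hX j) (hY j) (hd i) hXY hne (hfreq.mono fun n ⟨hi, hj⟩ =>
      ⟨hi.1, hj.1, hi.2.1.trans hj.2.1.symm, hi.2.2.trans hj.2.2.symm⟩)
  have hX' := (hX i).eq_translate_of_eq (hX j) hXN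
  have hY' := (hY i).eq_translate_of_eq (hY j) hYN
  rw [hX0, hX0, translate_translate] at hX'
  rw [hY0, hY0, translate_translate] at hY'
  exact hij (hdisj i j _ (translate_eq_translate_iff.1 hX'.symm).symm
    (translate_eq_translate_iff.1 hY'.symm).symm)

end Topology

end Subst

namespace Subst

variable {A : Type*} {τ : A → List A} {p : ℕ}

/-! ### Towers with prescribed digits -/

lemma onSeq_eq_block (hp : 0 < p) (x : ℤ → A) {j : ℤ} (h0 : 0 ≤ j) (h1 : j < p) :
    onSeq τ p x j = block τ p 1 (x 0) j := by
  simpa using onSeq_iterate_eq_block hp 1 x (q := 0) h0 (by simpa using h1)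

lemma exists_levels_of_digits (hlen : HasConstLength τ p) (hp : 0 < p) {a : A} {z : ℤ → A}
    (hz : z ∈ subshift τ) (hza : z 0 = a) (N : ℕ) {d : ℕ → ℤ} (hd : ∀ n, d n ∈ Set.Ico (0 : ℤ) p)
    (hret : ∀ n, block τ p 1 a (d n) = a) :
    ∃ X : ℕ → ℤ → A, (∀ n, X n ∈ subshift τ ∧ X n 0 = a) ∧
      ∀ n < N, X n = translate (d n) (onSeq τ p (X (n + 1))) := by
  induction N generalizing d with
  | zero => exact ⟨fun _ => z, fun _ => ⟨hz, hza⟩, fun n hn => absurd hn n.not_lt_zero⟩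
  | succ N ih =>
    obtain ⟨X, hX, heq⟩ := ih (d := fun n => d (n + 1)) (fun n => hd (n + 1)) fun n => hret (n + 1)
    have hcentral : translate (d 0) (onSeq τ p (X 0)) 0 = a := by
      rw [translate_apply, zero_add, onSeq_eq_block hp (X 0) (hd 0).1 (hd 0).2, (hX 0).2, hret]
    refine ⟨fun n => n.casesOn (translate (d 0) (onSeq τ p (X 0))) X, fun n => ?_, fun n hn => ?_⟩
    · cases n with
      | zero => exact ⟨translate_mem_subshift (onSeq_mem_subshift hlen hp (hX 0).1) _, hcentral⟩
      | succ n => exact hX n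
    · cases n with
      | zero => rfl
      | succ n => exact heq n (Nat.lt_of_succ_lt_succ hn)

lemma exists_isTower_of_digits [Finite A] [TopologicalSpace A] [DiscreteTopology A]
    (hlen : HasConstLength τ p) (hp : 0 < p) {a : A} {z : ℤ → A} (hz : z ∈ subshift τ)
    (hza : z 0 = a) {d : ℕ → ℤ} (hd : ∀ n, d n ∈ Set.Ico (0 : ℤ) p)
    (hret : ∀ n, block τ p 1 a (d n) = a) :
    ∃ X, IsTower τ p X d ∧ ∀ n, X n 0 = a := by
  let F : ℕ → Set (ℕ → ℤ → A) := fun N => {X | (∀ n, X n ∈ subshift τ ∧ X n 0 = a) ∧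
    ∀ n < N, X n = translate (d n) (onSeq τ p (X (n + 1)))}
  have hclosed : ∀ N, IsClosed (F N) := fun N => by
    simp only [F, Set.ofPred_and, Set.ofPred_forall]
    refine (isClosed_iInter fun n => ?_).inter
      (isClosed_iInter fun n => isClosed_iInter fun _ => ?_)
    · exact ((isClosed_subshift τ).preimage (continuous_apply n)).inter
        (isClosed_eq (continuous_apply_apply n 0) continuous_const)
    · exact isClosed_eq (continuous_apply n) ((continuous_translate (d n)).comp
        ((continuous_onSeq τ p).comp (continuous_apply (n + 1))))
  obtain ⟨X, hX⟩ := IsCompact.nonempty_iInter_of_sequence_nonempty_isCompact_isClosed F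
    (fun N X hX => ⟨hX.1, fun n hn => hX.2 n (Nat.lt_succ_of_lt hn)⟩)
    (fun N => exists_levels_of_digits hlen hp hz hza N hd hret) (hclosed 0).isCompact hclosed
  rw [Set.mem_iInter] at hX
  exact ⟨X, ⟨fun n => ((hX 0).1 n).1, hd, fun n => (hX (n + 1)).2 n n.lt_succ_self⟩,
    fun n => ((hX 0).1 n).2⟩

lemma frequently_atTop_of_pow_mul (hp : 2 ≤ p) {c : ℕ} (hc : 0 < c) {P : ℕ → Prop}
    (h : ∃ᶠ n in atTop, P (p ^ n * c)) : ∃ᶠ s in atTop, P s :=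
  ((tendsto_pow_atTop_atTop_of_one_lt hp).atTop_mul_const' hc).frequently h

namespace IsTower

variable {X Y : ℕ → ℤ → A} {d : ℕ → ℤ} {a b : A} {i j k : ℤ}

lemma apply_eq_block_one (hX : IsTower τ p X d) {n : ℕ} (hn : X (n + 1) 0 = a) (h0 : 0 ≤ i + d n)
    (h1 : i + d n < p) : X n i = block τ p 1 a (i + d n) := by
  rw [hX.eq_translate n, translate_apply, onSeq_eq_block hX.pos _ h0 h1, hn]

lemma eqOn_window (hX : IsTower τ p X d) (hY : IsTower τ p Y d) {n L : ℕ}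
    (h0 : L ≤ offset p d n) (h1 : L + offset p d n < (p : ℤ) ^ n) {q r : ℤ} (hqr : X n q = Y n r) :
    Set.EqOn (translate (p ^ n * q) (X 0)) (translate (p ^ n * r) (Y 0)) (window L) := by
  intro t ht
  rw [mem_window] at ht
  rw [translate_apply, translate_apply, add_comm t, add_comm t,
    hX.apply_eq_block n q (by omega) (by omega), hY.apply_eq_block n r (by omega) (by omega), hqr]

lemma eventually_eqOn_window (hX : IsTower τ p X d) (hd0 : ∃ᶠ n in atTop, d n ≠ 0)
    (hd1 : ∃ᶠ n in atTop, d n ≠ p - 1) (L : ℕ) :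
    ∀ᶠ n in atTop, ∀ (Y : ℕ → ℤ → A), IsTower τ p Y d → ∀ q r, X n q = Y n r →
      Set.EqOn (translate (p ^ n * q) (X 0)) (translate (p ^ n * r) (Y 0)) (window L) := by
  filter_upwards [(tendsto_offset hX.pos (fun n => (hX.digit_mem n).1) hd0).eventually_ge_atTop
    (L : ℤ), hX.eventually_add_offset_lt hd1 L] with n h0 h1 Y hY q r hqr
  exact hX.eqOn_window hY h0 h1 hqr

lemma proximal_of_isCoincidence (hX : IsTower τ p X d) (hY : IsTower τ p Y d) (hp : 2 ≤ p)
    (hXa : ∀ n, X n 0 = a) (hYb : ∀ n, Y n 0 = b) (hd0 : ∃ᶠ n in atTop, d n ≠ 0)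
    (hd1 : ∃ᶠ n in atTop, d n ≠ p - 1) (hi : ∃ᶠ n in atTop, d n = i)
    (hk : IsCoincidence τ p 1 a b k) (hik : i < k) : Proximal (X 0) (Y 0) := by
  obtain ⟨c, hc⟩ := Int.eq_ofNat_of_zero_le (sub_nonneg.2 hik.le)
  refine fun L => frequently_atTop_of_pow_mul hp (c := c) (by omega) ?_
  refine (hi.and_eventually (hX.eventually_eqOn_window hd0 hd1 L)).mono fun n ⟨hn, heq⟩ => ?_
  have hkn : c + d n = k := by rw [hn]; omega
  have hlt : c + d n < p := by rw [hkn]; simpa using hk.lt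
  have h0 : 0 ≤ c + d n := hkn ▸ hk.nonneg
  have hXY : X n c = Y n c := by
    rw [hX.apply_eq_block_one (hXa _) h0 hlt, hY.apply_eq_block_one (hYb _) h0 hlt, hkn, hk.eq]
  simpa using heq Y hY c c hXY

lemma recurrentPair_of_isCommonReturn (hX : IsTower τ p X d) (hY : IsTower τ p Y d) (hp : 2 ≤ p)
    (hXa : ∀ n, X n 0 = a) (hYb : ∀ n, Y n 0 = b) (hd0 : ∃ᶠ n in atTop, d n ≠ 0)
    (hd1 : ∃ᶠ n in atTop, d n ≠ p - 1) (hi : ∃ᶠ n in atTop, d n = i)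
    (hj : IsCommonReturn τ p 1 a b j) (hij : i < j) : RecurrentPair (X 0) (Y 0) := by
  obtain ⟨c, hc⟩ := Int.eq_ofNat_of_zero_le (sub_nonneg.2 hij.le)
  refine fun L => frequently_atTop_of_pow_mul hp (c := c) (by omega) ?_
  refine (hi.and_eventually ((hX.eventually_eqOn_window hd0 hd1 L).and
    (hY.eventually_eqOn_window hd0 hd1 L))).mono fun n ⟨hn, heqX, heqY⟩ => ?_
  have hjn : c + d n = j := by rw [hn]; omega
  have hlt : c + d n < p := by rw [hjn]; simpa using hj.lt
  have h0 : 0 ≤ c + d n := hjn ▸ hj.nonneg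
  have hXc : X n c = X n 0 := by
    rw [hX.apply_eq_block_one (hXa _) h0 hlt, hjn, hj.left, hXa]
  have hYc : Y n c = Y n 0 := by
    rw [hY.apply_eq_block_one (hYb _) h0 hlt, hjn, hj.right, hYb]
  simpa using And.intro (heqX X hX c 0 hXc) (heqY Y hY c 0 hYc)

end IsTower

/-- The sequence in `i` and `j` which encodes `ε` and takes both values infinitely often: of the two
entries at `2 * n` and `2 * n + 1`, the one selected by the bit `ε n` is `i` and the other one is
`j`. -/
def interleave (i j : ℤ) (ε : ℕ → Bool) (n : ℕ) : ℤ := if ε n.div2 = n.bodd then i else j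

lemma interleave_bit (i j : ℤ) (ε : ℕ → Bool) (c : Bool) (n : ℕ) :
    interleave i j ε (Nat.bit c n) = if ε n = c then i else j := by
  simp [interleave]

lemma interleave_eq_or (i j : ℤ) (ε : ℕ → Bool) (n : ℕ) :
    interleave i j ε n = i ∨ interleave i j ε n = j :=
  ite_eq_or_eq _ i j

lemma frequently_atTop_of_bit {P : ℕ → Prop} (h : ∀ n, ∃ c, P (Nat.bit c n)) :
    ∃ᶠ n in atTop, P n := by
  refine frequently_atTop.2 fun n => ?_
  obtain ⟨c, hc⟩ := h n
  exact ⟨Nat.bit c n, by rw [Nat.bit_val]; omega, hc⟩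

lemma frequently_interleave_eq_left (i j : ℤ) (ε : ℕ → Bool) :
    ∃ᶠ n in atTop, interleave i j ε n = i :=
  frequently_atTop_of_bit fun n => ⟨ε n, by rw [interleave_bit, if_pos rfl]⟩

lemma frequently_interleave_eq_right (i j : ℤ) (ε : ℕ → Bool) :
    ∃ᶠ n in atTop, interleave i j ε n = j :=
  frequently_atTop_of_bit fun n => ⟨!ε n, by
    rw [interleave_bit, if_neg (Bool.self_ne_not (ε n))]⟩

lemma interleave_injective {i j : ℤ} (hij : i ≠ j) : Function.Injective (interleave i j) := by
  intro ε ε' h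
  funext n
  have hn := congrFun h (Nat.bit (ε n) n)
  rw [interleave_bit, interleave_bit, if_pos rfl] at hn
  by_contra hne
  rw [if_neg (Ne.symm hne)] at hn
  exact hij hn

section Power

variable {m : ℕ} {a b : A}

lemma isCommonReturn_power_iff (hlen : HasConstLength τ p)
    (hlen' : HasConstLength (iter τ m) (p ^ m)) {i : ℕ} :
    IsCommonReturn (iter τ m) (p ^ m) 1 a b i ↔ IsCommonReturn τ p m a b i := by
  rw [isCommonReturn_iff_getElem? hlen', isCommonReturn_iff_getElem? hlen, iter_iter, mul_one]

lemma isCoincidence_power_iff (hlen : HasConstLength τ p)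
    (hlen' : HasConstLength (iter τ m) (p ^ m)) {k : ℕ} :
    IsCoincidence (iter τ m) (p ^ m) 1 a b k ↔ IsCoincidence τ p m a b k := by
  rw [isCoincidence_iff_getElem? hlen', isCoincidence_iff_getElem? hlen, iter_iter, mul_one]

end Power

section Topology

variable [Finite A] [TopologicalSpace A] [DiscreteTopology A]

lemma IsPrimitiveOfLength.exists_apply_zero_eq (h : IsPrimitiveOfLength τ p) (a : A) :
    ∃ z ∈ subshift τ, z 0 = a := by
  obtain ⟨x, hx, i, hi⟩ := (isLeast_subshift h.two_le h.constLength h.isPrimitive).1.2 0 a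
  refine ⟨translate i x, translate_mem_subshift hx i, ?_⟩
  simpa [iter] using (factor_eq_iff x i _).1 hi 0 (by simp [iter])

lemma IsAperiodicOfLength.exists_injective_of_isCommonReturn (h : IsAperiodicOfLength τ p) {a b : A}
    {i j k : ℤ} (hab : a ≠ b) (hi : IsCommonReturn τ p 1 a b i) (hj : IsCommonReturn τ p 1 a b j)
    (hij : i < j) (hk : IsCoincidence τ p 1 a b k) (hik : i < k) :
    ∃ x y : (ℕ → Bool) → ℤ → A, Function.Injective x ∧ ∀ ε, x ε ∈ subshift τ ∧ y ε ∈ subshift τ ∧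
      Proximal (x ε) (y ε) ∧ ¬ Asymptotic (x ε) (y ε) ∧ RecurrentPair (x ε) (y ε) := by
  have hj1 : j < p := by simpa using hj.lt
  have hdigit : ∀ ε n, IsCommonReturn τ p 1 a b (interleave i j ε n) := fun ε n =>
    (interleave_eq_or i j ε n).elim (fun h => h.symm ▸ hi) fun h => h.symm ▸ hj
  have hmem : ∀ ε n, interleave i j ε n ∈ Set.Ico (0 : ℤ) p := fun ε n =>
    ⟨(hdigit ε n).nonneg, by simpa using (hdigit ε n).lt⟩
  obtain ⟨za, hza, hza0⟩ := h.exists_apply_zero_eq a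
  obtain ⟨zb, hzb, hzb0⟩ := h.exists_apply_zero_eq b
  choose X hX hXa using fun ε => exists_isTower_of_digits h.constLength h.pos hza hza0 (hmem ε)
    fun n => (hdigit ε n).left
  choose Y hY hYb using fun ε => exists_isTower_of_digits h.constLength h.pos hzb hzb0 (hmem ε)
    fun n => (hdigit ε n).right
  refine ⟨fun ε => X ε 0, fun ε => Y ε 0, fun ε ε' hεε' => interleave_injective hij.ne <|
    funext fun n => ?_, fun ε => ?_⟩
  · have hεε' : X ε 0 = X ε' 0 := hεε'
    exact ((hX ε).proximal_and_digit_eq (hX ε') h (hεε' ▸ Proximal.refl _) n).2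
  · have hfi := frequently_interleave_eq_left i j ε
    have hd0 : ∃ᶠ n in atTop, interleave i j ε n ≠ 0 :=
      (frequently_interleave_eq_right i j ε).mono fun n hn => by rw [hn]; linarith [hi.nonneg]
    have hd1 : ∃ᶠ n in atTop, interleave i j ε n ≠ p - 1 := hfi.mono fun n hn => by rw [hn]; omega
    have hrec := (hX ε).recurrentPair_of_isCommonReturn (hY ε) h.two_le (hXa ε) (hYb ε) hd0 hd1
      hfi hj hij
    have hne : X ε 0 ≠ Y ε 0 := fun heq => hab (by rw [← hXa ε 0, ← hYb ε 0, heq])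
    exact ⟨(hX ε).mem_subshift 0, (hY ε).mem_subshift 0,
      (hX ε).proximal_of_isCoincidence (hY ε) h.two_le (hXa ε) (hYb ε) hd0 hd1 hfi hk hik,
      hrec.not_asymptotic hne, hrec⟩

theorem IsAperiodicOfLength.exists_injective_of_doubleReturnCondition
    (h : IsAperiodicOfLength τ p) (hD : DoubleReturnCondition τ) :
    ∃ x y : (ℕ → Bool) → ℤ → A, Function.Injective x ∧ ∀ ε, x ε ∈ subshift τ ∧ y ε ∈ subshift τ ∧
      Proximal (x ε) (y ε) ∧ ¬ Asymptotic (x ε) (y ε) ∧ RecurrentPair (x ε) (y ε) := by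
  obtain ⟨m, a, b, i, j, k, hab, hi, hj, hij, hk, hik⟩ :=
    (doubleReturnCondition_iff h.constLength).1 hD
  have hm : m ≠ 0 := by
    rintro rfl
    have := hi.nonneg
    have := hj.lt
    rw [pow_zero] at this
    omega
  have hpow := h.power hm
  lift i to ℕ using hi.nonneg
  lift j to ℕ using hj.nonneg
  lift k to ℕ using hk.nonneg
  rw [← h.subshift_power hm]
  exact hpow.exists_injective_of_isCommonReturn hab
    ((isCommonReturn_power_iff h.constLength hpow.constLength).2 hi)
    ((isCommonReturn_power_iff h.constLength hpow.constLength).2 hj) hij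
    ((isCoincidence_power_iff h.constLength hpow.constLength).2 hk) hik

end Topology

end Subst

/-! ### Metrics inducing the product topology -/

namespace LiYorke

variable {X : Type*}

lemma isLiYorkePair_iff_uniformity [MetricSpace X] {T : X → X} {z : X × X} :
    IsLiYorkePair T z ↔ (∀ V ∈ uniformity X, ∃ᶠ n in atTop, (T^[n] z.1, T^[n] z.2) ∈ V) ∧
      ¬ ∀ V ∈ uniformity X, ∀ᶠ n in atTop, (T^[n] z.1, T^[n] z.2) ∈ V := by
  rw [IsLiYorkePair, ← not_le, ← le_zero_iff, limsup_le_iff, liminf_le_iff, and_comm,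
    uniformity_basis_edist.forall_iff fun V W hVW h => h.mono fun n hn => hVW hn,
    uniformity_basis_edist.forall_iff fun V W hVW h => h.mono fun n hn => hVW hn]
  rfl

lemma countable_of_countable_pairOrbit (T : Equiv.Perm X) {S : Set (X × X)}
    (h : (pairOrbit T '' S).Countable) : S.Countable := by
  refine Set.Countable.mono (fun z hz => ?_) (h.sUnion ?_)
  · exact Set.mem_sUnion.2 ⟨_, ⟨z, hz, rfl⟩, 0, by simp⟩
  · rintro _ ⟨z, -, rfl⟩
    exact Set.countable_range _

lemma pairOrbit_zpow (T : Equiv.Perm X) (k : ℤ) (z : X × X) :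
    pairOrbit T ((T ^ k) z.1, (T ^ k) z.2) = pairOrbit T z := by
  simp only [pairOrbit, ← Equiv.Perm.mul_apply, ← zpow_add]
  exact (Equiv.addRight k).surjective.range_comp fun n : ℤ => ((T ^ n) z.1, (T ^ n) z.2)

end LiYorke

namespace Subst

variable {A X : Type*} {τ : A → List A} {p : ℕ}

lemma asymptotic_iff_forall_window {x y : ℤ → A} : Asymptotic x y ↔
    ∀ L : ℕ, ∀ᶠ s : ℕ in atTop, Set.EqOn (translate s x) (translate s y) (window L) := by
  refine ⟨fun h L => ?_, fun h => (h 0).mono fun s hs => ?_⟩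
  · obtain ⟨N, hN⟩ := eventually_atTop.1 h
    filter_upwards [eventually_ge_atTop (N + L)] with s hs i hi
    rw [mem_window] at hi
    have := hN (i + s).toNat (by omega)
    rwa [Int.toNat_of_nonneg (by omega)] at this
  · simpa using hs (natAbs_mem_window 0)

lemma translate_iterate_of_semiconj {f : X → ℤ → A} {T : X → X}
    (hT : Function.Semiconj f T (translate 1)) (n : ℕ) (x : X) :
    f (T^[n] x) = translate n (f x) := by
  rw [(hT.iterate_right n).eq, translate_iterate, mul_one]

lemma shift_zpow (k : ℤ) (x : subshift τ) : ((shift τ ^ k) x : ℤ → A) = translate k x := by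
  induction k generalizing x with
  | zero => simp
  | succ i ih =>
    rw [zpow_add_one, Equiv.Perm.mul_apply, ih]
    exact translate_translate i 1 _
  | pred i ih =>
    rw [zpow_sub_one, Equiv.Perm.mul_apply, ih]
    exact translate_translate (-i) (-1) _

section Coding

variable [TopologicalSpace A] [DiscreteTopology A]

lemma hasAntitoneBasis_uniformity [UniformSpace X] [CompactSpace X] {f : X → ℤ → A}
    (hf : IsEmbedding f) :
    (uniformity X).HasAntitoneBasis
      fun L : ℕ => {z | Set.EqOn (f z.1) (f z.2) (window L)} := by
  have hff : Continuous (Prod.map f f) := hf.continuous.prodMap hf.continuous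
  have : T2Space X := hf.t2Space
  refine ⟨⟨fun V => ⟨fun hV => ?_, fun ⟨L, _, hL⟩ => mem_of_superset ?_ hL⟩⟩,
    fun L M hLM z hz => hz.mono (window_mono hLM)⟩
  · obtain ⟨U, ⟨hU, hUo⟩, hUV⟩ := uniformity_hasBasis_open.mem_iff.1 hV
    obtain ⟨L, hL⟩ := exists_window_of_isCompact (hUo.isClosed_compl.isCompact.image hff) (by
      rintro _ ⟨⟨x, y⟩, hxy, rfl⟩ heq
      obtain rfl : x = y := hf.injective heq
      exact hxy (refl_mem_uniformity hU))
    exact ⟨L, trivial, fun z hz => hUV (by_contra fun hzU => hL _ ⟨z, hzU, rfl⟩ hz)⟩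
  · rw [← nhdsSet_diagonal_eq_uniformity]
    refine ((isOpen_eqOn (Set.finite_Icc _ _)).preimage hff).mem_nhdsSet.2 ?_
    rintro ⟨x, y⟩ (rfl : x = y)
    exact Set.eqOn_refl _ _

variable {f : X → ℤ → A} {T : X → X}

theorem isLiYorkePair_iff [MetricSpace X] [CompactSpace X] (hf : IsEmbedding f)
    (hT : Function.Semiconj f T (translate 1)) {z : X × X} :
    LiYorke.IsLiYorkePair T z ↔ Proximal (f z.1) (f z.2) ∧ ¬ Asymptotic (f z.1) (f z.2) := by
  have hb := (hasAntitoneBasis_uniformity hf).toHasBasis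
  rw [LiYorke.isLiYorkePair_iff_uniformity, asymptotic_iff_forall_window,
    hb.forall_iff fun V W hVW h => h.mono fun n hn => hVW hn,
    hb.forall_iff fun V W hVW h => h.mono fun n hn => hVW hn]
  simp only [Set.mem_ofPred_eq, translate_iterate_of_semiconj hT, forall_const, Proximal]

theorem isRecurrentPt_prodMap_iff [UniformSpace X] [CompactSpace X] (hf : IsEmbedding f)
    (hT : Function.Semiconj f T (translate 1)) {z : X × X} :
    LiYorke.IsRecurrentPt (Prod.map T T) z ↔ RecurrentPair (f z.1) (f z.2) := by
  have hb := hasAntitoneBasis_uniformity hf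
  have hz := (hb.comap fun x => (x, z.1)).prod (hb.comap fun x => (x, z.2))
  rw [← nhds_eq_comap_uniformity', ← nhds_eq_comap_uniformity', ← nhds_prod_eq] at hz
  rw [LiYorke.IsRecurrentPt,
    hz.toHasBasis.forall_iff fun V W hVW h => h.mono fun n hn => hVW hn]
  simp only [Prod.map_iterate, Set.mem_prod, Set.mem_preimage, Set.mem_ofPred_eq, Prod.map_fst,
    Prod.map_snd, translate_iterate_of_semiconj hT, forall_const, RecurrentPair]

end Coding

end Subst

namespace Subst

variable {A : Type*} {τ : A → List A} {p : ℕ}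

section Shift

variable [TopologicalSpace A] [ρ : MetricSpace (subshift τ)]
  (hρ : ρ.toPseudoMetricSpace.toUniformSpace.toTopologicalSpace =
    TopologicalSpace.induced Subtype.val Pi.topologicalSpace)

include hρ

lemma isEmbedding_val_of_eq_induced :
    @IsEmbedding (subshift τ) (ℤ → A) ρ.toPseudoMetricSpace.toUniformSpace.toTopologicalSpace _
      Subtype.val := by
  rw [hρ]
  exact .subtypeVal

variable [Finite A] [DiscreteTopology A]

lemma compactSpace_of_eq_induced :
    @CompactSpace (subshift τ) ρ.toPseudoMetricSpace.toUniformSpace.toTopologicalSpace := by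
  rw [hρ]
  exact isCompact_iff_compactSpace.1 (isCompact_subshift τ)

lemma isLiYorkePair_shift_iff {z : subshift τ × subshift τ} :
    LiYorke.IsLiYorkePair (shift τ) z ↔
      Proximal (z.1 : ℤ → A) z.2 ∧ ¬ Asymptotic (z.1 : ℤ → A) z.2 := by
  have := compactSpace_of_eq_induced hρ
  exact isLiYorkePair_iff (isEmbedding_val_of_eq_induced hρ) fun _ => rfl

lemma isStrongLiYorkePair_shift_iff {z : subshift τ × subshift τ} :
    LiYorke.IsStrongLiYorkePair (shift τ) z ↔
      (Proximal (z.1 : ℤ → A) z.2 ∧ ¬ Asymptotic (z.1 : ℤ → A) z.2) ∧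
        RecurrentPair (z.1 : ℤ → A) z.2 := by
  have := compactSpace_of_eq_induced hρ
  exact and_congr (isLiYorkePair_shift_iff hρ)
    (isRecurrentPt_prodMap_iff (isEmbedding_val_of_eq_induced hρ) fun _ => rfl)

namespace IsAperiodicOfLength

theorem doubleReturnCondition_of_infinite_liYorkeOrbits (h : IsAperiodicOfLength τ p)
    (horb : (LiYorke.liYorkeOrbits (shift τ)).Infinite) : DoubleReturnCondition τ := by
  have := horb.to_subtype
  choose z hz hzO using fun O : LiYorke.liYorkeOrbits (shift τ) => O.2
  have hLY := fun O => (isLiYorkePair_shift_iff hρ).1 (hz O)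
  refine h.doubleReturnCondition_of_infinite (fun O => (z O).1.2) (fun O => (z O).2.2)
    (fun O => (hLY O).1) (fun O => (hLY O).2) fun O O' k hx hy => Subtype.ext ?_
  have hzk : z O = ((shift τ ^ k) (z O').1, (shift τ ^ k) (z O').2) :=
    Prod.ext (Subtype.ext (hx.trans (shift_zpow k _).symm))
      (Subtype.ext (hy.trans (shift_zpow k _).symm))
  rw [← hzO O, ← hzO O', hzk, LiYorke.pairOrbit_zpow]

theorem doubleReturnCondition_of_isStrongLiYorkePair (h : IsAperiodicOfLength τ p)
    {z : subshift τ × subshift τ} (hz : LiYorke.IsStrongLiYorkePair (shift τ) z) :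
    DoubleReturnCondition τ := by
  obtain ⟨⟨hprox, hna⟩, hrec⟩ := (isStrongLiYorkePair_shift_iff hρ).1 hz
  exact h.doubleReturnCondition_of_recurrentPair z.1.2 z.2.2 hprox hna hrec

theorem not_countable_strongLiYorkeOrbits (h : IsAperiodicOfLength τ p)
    (hD : DoubleReturnCondition τ) : ¬ (LiYorke.strongLiYorkeOrbits (shift τ)).Countable := by
  intro horb
  obtain ⟨x, y, hx, hxy⟩ := h.exists_injective_of_doubleReturnCondition hD
  choose hxτ hyτ hprox hna hrec using hxy
  let z : (ℕ → Bool) → subshift τ × subshift τ := fun ε => (⟨x ε, hxτ ε⟩, ⟨y ε, hyτ ε⟩)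
  have hz : Function.Injective z := fun ε ε' hεε' =>
    hx (congrArg (fun w : subshift τ × subshift τ => (w.1 : ℤ → A)) hεε')
  have hcount := (LiYorke.countable_of_countable_pairOrbit _ horb).preimage_of_injOn hz.injOn
  have huniv : z ⁻¹' LiYorke.strongLiYorkePairs (shift τ) = Set.univ :=
    Set.eq_univ_of_forall fun ε =>
      (isStrongLiYorkePair_shift_iff hρ).2 ⟨⟨hprox ε, hna ε⟩, hrec ε⟩
  rw [huniv, Set.countable_univ_iff] at hcount
  exact (Cardinal.cantor Cardinal.aleph0).not_ge
    (by simpa only [Cardinal.mk_arrow, Cardinal.mk_bool, Cardinal.mk_nat, Cardinal.lift_id,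
      Cardinal.lift_uzero] using Cardinal.mk_le_aleph0 (α := ℕ → Bool))

end IsAperiodicOfLength

end Shift

end Subst

theorem corollary3p10 {A : Type*} [Finite A] [TopologicalSpace A] [DiscreteTopology A]
    (τ : A → List A) (p : ℕ) (hp : 2 ≤ p) (hlen : Subst.HasConstLength τ p)
    (hprim : Subst.IsPrimitive τ) (hinj : Function.Injective τ)
    (hinf : (Subst.subshift τ).Infinite)
    -- any metric on the subshift that induces its topology as a subspace of the product
    [ρ : MetricSpace (Subst.subshift τ)]
    (hρ : ρ.toPseudoMetricSpace.toUniformSpace.toTopologicalSpace =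
      TopologicalSpace.induced Subtype.val Pi.topologicalSpace) :
    List.TFAE [
      ¬ (LiYorke.liYorkePairs (Subst.shift τ)).Countable,
      (LiYorke.liYorkeOrbits (Subst.shift τ)).Infinite,
      (LiYorke.strongLiYorkePairs (Subst.shift τ)).Nonempty,
      ¬ (LiYorke.strongLiYorkeOrbits (Subst.shift τ)).Countable,
      Subst.DoubleReturnCondition τ] := by
  have h : Subst.IsAperiodicOfLength τ p := ⟨⟨hp, hlen, hprim⟩, hinj, hinf⟩
  tfae_have 1 → 2 := fun hunc hfin =>
    hunc (LiYorke.countable_of_countable_pairOrbit _ (Set.Finite.countable hfin))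
  tfae_have 2 → 5 := h.doubleReturnCondition_of_infinite_liYorkeOrbits hρ
  tfae_have 3 → 5 := fun ⟨_, hz⟩ => h.doubleReturnCondition_of_isStrongLiYorkePair hρ hz
  tfae_have 5 → 4 := h.not_countable_strongLiYorkeOrbits hρ
  tfae_have 4 → 3 := fun hunc =>
    (Set.Infinite.nonempty (mt Set.Finite.countable hunc)).of_image
  tfae_have 4 → 1 := fun hunc hc => hunc ((hc.mono fun _ hz => hz.1).image _)
  tfae_finish
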